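/- Let $n\ge 0$ be an integer. A convex body $\Omega\subset\mathbb R^{n+1}$ is a compact convex set with nonempty interior; $V$ denotes volume and $B(1)$ the closed unit ball. For $z_0\in\Omega$ let $u_{z_0}(x)=\max_{z\in\Omega}\langle x,z-z_0\rangle$, $x\in\mathbb S^n$, be the support function of $\Omega$ with respect to $z_0$, let $\omega_n$ be the area of $\mathbb S^n$, let $d\theta$ be its surface measure, and let $$\mathcal E(\Omega)=\sup\Big\{\frac1{\omega_n}\int_{\mathbb S^n}\log u_{z_0}\,d\theta \;:\; z_0\in\Omega,\ u_{z_0}>0\text{ on }\mathbb S^n\Big\}.$$ A Santaló point of $\Omega$ is a point $z_s\in\Omega$ at which the volume of the polar dual $\Omega^*_{z_0}=\{y+z_0 : \langle y,z-z_0\rangle\le 1\ \text{for all } z\in\Omega\}$ is minimal among all $z_0\in\Omega$. (1) If $V(\Omega)=V(B(1))$, then $\Omega$ has exactly one Santaló point $z_s$, and with $u_s=u_{z_s}$, $$\frac1{\omega_n}\int_{\mathbb S^n}\log u_s\,d\theta\ge 0,$$ with equality if and only if $\Omega$ is the closed unit ball centered at $z_s$. Moreover $\mathcal E(\Omega)\ge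 0$, with equality if and only if $\Omega$ is the closed unit ball centered at $z_s$. (2) For every convex body $\Omega$ (without volume normalization), $$\mathcal E(\Omega)\ge\frac{\log V(\Omega)-\log V(B(1))}{n+1}.$$ -/

import Mathlib

open MeasureTheory

/-- The support function `u_{z₀}(x) = max_{z ∈ Ω} ⟨x, z - z₀⟩` of a convex body `Ω` with respect to
the point `z₀`. The maximum exists because a `ConvexBody` is compact and nonempty. -/
noncomputable def supportFn {n : ℕ} (Ω : ConvexBody (EuclideanSpace ℝ (Fin (n + 1))))
    (z₀ x : EuclideanSpace ℝ (Fin (n + 1))) : ℝ :=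
  sSup ((fun z => inner ℝ x (z - z₀)) '' (Ω : Set (EuclideanSpace ℝ (Fin (n + 1)))))

/-- The polar dual of `Ω` with respect to `z₀`, that is, the set of all `y + z₀` such that
`⟨y, z - z₀⟩ ≤ 1` for all `z ∈ Ω`. -/
def polarDual {n : ℕ} (Ω : ConvexBody (EuclideanSpace ℝ (Fin (n + 1))))
    (z₀ : EuclideanSpace ℝ (Fin (n + 1))) : Set (EuclideanSpace ℝ (Fin (n + 1))) :=
  {w | ∀ z ∈ Ω, inner ℝ (w - z₀) (z - z₀) ≤ 1}

/-- `z` is a Santaló point of `Ω`: the polar dual of `Ω` with respect to `z` has the least volume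
among the polar duals with respect to the points of `Ω` (volumes may be infinite). -/
def IsSantaloPoint {n : ℕ} (Ω : ConvexBody (EuclideanSpace ℝ (Fin (n + 1))))
    (z : EuclideanSpace ℝ (Fin (n + 1))) : Prop :=
  z ∈ Ω ∧ ∀ w ∈ Ω, volume (polarDual Ω z) ≤ volume (polarDual Ω w)

/-- The surface measure of the unit sphere `𝕊ⁿ` of `ℝⁿ⁺¹`. -/
noncomputable def sphereMeasure (n : ℕ) :
    Measure (Metric.sphere (0 : EuclideanSpace ℝ (Fin (n + 1))) 1) :=
  (volume : Measure (EuclideanSpace ℝ (Fin (n + 1)))).toSphere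

/-- `(1 / ω_n) ∫_{𝕊ⁿ} log u_{z₀} dθ`, where `ω_n` is the area of `𝕊ⁿ`. -/
noncomputable def meanLogSupport {n : ℕ} (Ω : ConvexBody (EuclideanSpace ℝ (Fin (n + 1))))
    (z₀ : EuclideanSpace ℝ (Fin (n + 1))) : ℝ :=
  (1 / (sphereMeasure n).real Set.univ) *
    ∫ x : Metric.sphere (0 : EuclideanSpace ℝ (Fin (n + 1))) 1,
      Real.log (supportFn Ω z₀ x) ∂(sphereMeasure n)

/-- The entropy `𝓔(Ω)`: the supremum of `(1 / ω_n) ∫_{𝕊ⁿ} log u_{z₀} dθ` over all `z₀ ∈ Ω` whose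
support function `u_{z₀}` is positive on `𝕊ⁿ`. It is taken in the extended reals. -/
noncomputable def entropy {n : ℕ} (Ω : ConvexBody (EuclideanSpace ℝ (Fin (n + 1)))) : EReal :=
  sSup {e : EReal | ∃ z₀ ∈ Ω,
    (∀ x ∈ Metric.sphere (0 : EuclideanSpace ℝ (Fin (n + 1))) 1, 0 < supportFn Ω z₀ x) ∧
    e = (meanLogSupport Ω z₀ : EReal)}

/-! Everything rests on the Blaschke–Santaló inequality V(Ω) V(Ω*) ≤ V(B)², proved for the polar at
the barycenter and inherited by the polar at a Santaló point, whose volume is no larger. In polar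
coordinates V(Ω*) controls ∫ u^{-(n+1)} / (n+1), so the mean of u^{-(n+1)} is at most V(B)/V(Ω), and
Jensen's inequality for the logarithm bounds the mean of log u from below. If the volumes agree,
equality in Jensen forces u = 1, a unit ball; the equality case of Blaschke–Santaló is never needed.
Conversely, seen from a point at displacement a from its center, the unit ball has u = 1 - ⟨x, a⟩,
and log u ≤ -⟨x, a⟩ has mean zero by oddness, so its entropy is not positive.

Blaschke–Santaló comes from its functional form (`functionalSantalo`), by induction on the
dimension. On the half line it is the Prékopa–Leindler inequality in logarithmic coordinates. In
dimension n + 1, a hyperplane halves the mass of one function and a shear puts the barycenters of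
both halves on the first axis; integrating out the first coordinate then reduces each half to
dimension n (`exists_center`, `half_space`). Truncations of e^{-p²/2} and e^{-q²/2}, with p the
gauge and q the support function, carry the result over to bodies
(`volume_real_mul_le_of_sublevel`).

Santaló points are studied through ∫ e^{-u_z} = (n+1)! V(Ω*_z): since u_z(x) is affine in z, this is
lower semicontinuous, and strictly convex where finite, whence existence and uniqueness. -/

section BlaschkeSantalo

open Set Filter Topology
open scoped ENNReal Pointwise

/-! ### One-dimensional Brunn–Minkowski and Prékopa–Leindler inequalities -/

theorem isCompact_volume_add_le_two_mul {K L C : Set ℝ} (hK : IsCompact K) (hL : IsCompact L)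
    (hK0 : K.Nonempty) (hL0 : L.Nonempty) (h : ∀ a ∈ K, ∀ b ∈ L, (a + b) / 2 ∈ C) :
    volume K + volume L ≤ 2 * volume C := by
  obtain ⟨a, ha, hamax⟩ := hK.exists_isGreatest hK0
  obtain ⟨b, hb, hbmin⟩ := hL.exists_isLeast hL0
  have scale : ∀ (S : Set ℝ) (c : ℝ),
      2 * volume ((fun x => (2 : ℝ)⁻¹ * x) '' ((fun x => c + x) '' S)) = volume S := by
    intro S c
    have h1 : (fun x => (2 : ℝ)⁻¹ * x) '' ((fun x => c + x) '' S)
        = (2 : ℝ)⁻¹ • ((fun x => c + x) '' S) := rfl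
    rw [h1, Measure.addHaar_smul, image_add_left, measure_preimage_add]
    simp only [Module.finrank_self, pow_one]
    rw [← mul_assoc, abs_of_pos (by norm_num), ENNReal.ofReal_inv_of_pos (by norm_num)]
    norm_num
    rw [ENNReal.mul_inv_cancel (by norm_num) (by norm_num), one_mul]
  -- With a = max K and b = min L, the set (b + K)/2 lies to the left of (a + b)/2 and (a + L)/2 to
  -- its right. Both lie in C and they meet in at most one point.
  set K' := (fun x => (2 : ℝ)⁻¹ * x) '' ((fun x => b + x) '' K)
  set L' := (fun x => (2 : ℝ)⁻¹ * x) '' ((fun x => a + x) '' L)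
  have hL'm : MeasurableSet L' :=
    ((hL.image (by fun_prop)).image (by fun_prop)).measurableSet
  have hsub : K' ∪ L' ⊆ C := by
    rintro _ (⟨_, ⟨x, hx, rfl⟩, rfl⟩ | ⟨_, ⟨x, hx, rfl⟩, rfl⟩)
    · convert h x hx b hb using 1; ring
    · convert h a ha x hx using 1; ring
  have hdisj : AEDisjoint volume K' L' := by
    refine measure_mono_null (t := {(a + b) / 2}) ?_ (by simp)
    rintro _ ⟨⟨_, ⟨x, hx, rfl⟩, rfl⟩, ⟨_, ⟨y, hy, rfl⟩, hxy⟩⟩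
    have := hamax hx
    have := hbmin hy
    simp only [mem_singleton_iff] at *
    linarith
  calc volume K + volume L = 2 * volume (K' ∪ L') := by
        rw [measure_union₀ hL'm.nullMeasurableSet hdisj, mul_add, scale, scale]
    _ ≤ 2 * volume C := by gcongr

theorem volume_add_le_two_mul {A B C : Set ℝ} (hA : MeasurableSet A) (hB : MeasurableSet B)
    (hA0 : A.Nonempty) (hB0 : B.Nonempty) (h : ∀ a ∈ A, ∀ b ∈ B, (a + b) / 2 ∈ C) :
    volume A + volume B ≤ 2 * volume C := by
  obtain ⟨a0, ha0⟩ := hA0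
  obtain ⟨b0, hb0⟩ := hB0
  rw [hA.measure_eq_iSup_isCompact, hB.measure_eq_iSup_isCompact]
  simp only [iSup_and']
  refine ENNReal.biSup_add_biSup_le' ⟨{a0}, by simpa, isCompact_singleton⟩
    ⟨{b0}, by simpa, isCompact_singleton⟩ ?_
  rintro K ⟨hKA, hK⟩ L ⟨hLB, hL⟩
  -- A compact approximant may be empty; adjoining a fixed point of A or B repairs this.
  calc volume K + volume L ≤ volume (insert a0 K) + volume (insert b0 L) := by
        gcongr <;> exact subset_insert _ _
    _ ≤ 2 * volume C := by
        refine isCompact_volume_add_le_two_mul (hK.insert _) (hL.insert _) (insert_nonempty _ _)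
          (insert_nonempty _ _) fun a ha b hb => h a ?_ b ?_
        · exact insert_subset ha0 hKA ha
        · exact insert_subset hb0 hLB hb

/-- Layer cake: with both suprema equal to 1, {u > t} and {v > t} are both nonempty for t < 1, so
Brunn–Minkowski compares them with {w > t}, and both are empty for t ≥ 1. Without a common supremum
one set could be empty while the other is not. -/
theorem integral_add_le_two_mul_of_isLUB_one {u v w : ℝ → ℝ} (hu : Integrable u) (hv : Integrable v)
    (hw : Integrable w) (hum : Measurable u) (hvm : Measurable v)
    (hu0 : ∀ x, 0 ≤ u x) (hv0 : ∀ x, 0 ≤ v x) (hw0 : ∀ x, 0 ≤ w x)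
    (hu1 : IsLUB (range u) 1) (hv1 : IsLUB (range v) 1)
    (h : ∀ a b, u a * v b ≤ w ((a + b) / 2) ^ 2) :
    (∫ x, u x) + ∫ x, v x ≤ 2 * ∫ x, w x := by
  have key : (∫⁻ x, ENNReal.ofReal (u x)) + ∫⁻ x, ENNReal.ofReal (v x)
      ≤ 2 * ∫⁻ x, ENNReal.ofReal (w x) := by
    rw [lintegral_eq_lintegral_meas_lt _ (ae_of_all _ hu0) hu.aemeasurable,
      lintegral_eq_lintegral_meas_lt _ (ae_of_all _ hv0) hv.aemeasurable,
      lintegral_eq_lintegral_meas_lt _ (ae_of_all _ hw0) hw.aemeasurable,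
      ← lintegral_const_mul' _ _ (by norm_num), ← lintegral_add_left']
    · refine setLIntegral_mono' measurableSet_Ioi fun t (ht : 0 < t) => ?_
      rcases lt_or_ge t 1 with ht1 | ht1
      · obtain ⟨_, ⟨a, rfl⟩, ha⟩ := (lt_isLUB_iff hu1).1 ht1
        obtain ⟨_, ⟨b, rfl⟩, hb⟩ := (lt_isLUB_iff hv1).1 ht1
        refine volume_add_le_two_mul (hum measurableSet_Ioi) (hvm measurableSet_Ioi)
          ⟨a, ha⟩ ⟨b, hb⟩ fun a (ha : t < u a) b (hb : t < v b) => ?_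
        have h1 : t ^ 2 < w ((a + b) / 2) ^ 2 := by nlinarith [h a b]
        exact lt_of_pow_lt_pow_left₀ 2 (hw0 _) h1
      · have e1 : {a | t < u a} = ∅ :=
          eq_empty_of_forall_notMem fun a (ha : t < u a) =>
            absurd (hu1.1 ⟨a, rfl⟩) (by linarith)
        have e2 : {a | t < v a} = ∅ :=
          eq_empty_of_forall_notMem fun a (ha : t < v a) =>
            absurd (hv1.1 ⟨a, rfl⟩) (by linarith)
        simp [e1, e2]
    · exact (Antitone.measurable fun s t hst =>
        measure_mono fun x (hx : t < u x) => lt_of_le_of_lt hst hx).aemeasurable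
  rw [integral_eq_lintegral_of_nonneg_ae (ae_of_all _ hu0) hu.1,
    integral_eq_lintegral_of_nonneg_ae (ae_of_all _ hv0) hv.1,
    integral_eq_lintegral_of_nonneg_ae (ae_of_all _ hw0) hw.1,
    ← ENNReal.toReal_add (hu.lintegral_lt_top).ne (hv.lintegral_lt_top).ne]
  have := ENNReal.toReal_mono (ENNReal.mul_ne_top (by norm_num) hw.lintegral_lt_top.ne) key
  simpa using this

/-- The one-dimensional Prékopa–Leindler inequality, for exponents `1/2`. -/
theorem prekopa_leindler_real {u v w : ℝ → ℝ} (hu : Integrable u) (hv : Integrable v)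
    (hw : Integrable w) (hum : Measurable u) (hvm : Measurable v)
    (hu0 : ∀ x, 0 ≤ u x) (hv0 : ∀ x, 0 ≤ v x) (hw0 : ∀ x, 0 ≤ w x)
    (hub : BddAbove (range u)) (hvb : BddAbove (range v))
    (h : ∀ a b, u a * v b ≤ w ((a + b) / 2) ^ 2) :
    (∫ x, u x) * ∫ x, v x ≤ (∫ x, w x) ^ 2 := by
  have hα := isLUB_csSup (range_nonempty u) hub
  have hβ := isLUB_csSup (range_nonempty v) hvb
  set α := sSup (range u)
  set β := sSup (range v)
  have hα0 : 0 ≤ α := (hu0 0).trans (hα.1 ⟨0, rfl⟩)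
  have hβ0 : 0 ≤ β := (hv0 0).trans (hβ.1 ⟨0, rfl⟩)
  rcases hα0.eq_or_lt with h0 | hαp
  · have : u = 0 := funext fun x => le_antisymm ((hα.1 ⟨x, rfl⟩).trans h0.ge) (hu0 x)
    simp [this, sq_nonneg]
  rcases hβ0.eq_or_lt with h0 | hβp
  · have : v = 0 := funext fun x => le_antisymm ((hβ.1 ⟨x, rfl⟩).trans h0.ge) (hv0 x)
    simp [this, sq_nonneg]
  have lub : ∀ (f : ℝ → ℝ) (c : ℝ), 0 < c → IsLUB (range f) c →
      IsLUB (range fun x => c⁻¹ * f x) 1 := by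
    intro f c hc hf
    refine ⟨?_, fun b hb => ?_⟩
    · rintro _ ⟨x, rfl⟩
      exact inv_mul_le_one_of_le₀ (hf.1 ⟨x, rfl⟩) hc.le
    · have : c ≤ c * b := hf.2 (by
        rintro _ ⟨x, rfl⟩
        exact (inv_mul_le_iff₀ hc).1 (hb ⟨x, rfl⟩))
      nlinarith
  -- Dividing u, v and w by α, β and √(αβ) preserves the hypothesis. The additive inequality then
  -- becomes multiplicative by AM–GM.
  set γ := Real.sqrt (α * β)
  have hγ : γ ^ 2 = α * β := Real.sq_sqrt (by positivity)
  have hγ0 : 0 < γ := Real.sqrt_pos.2 (by positivity)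
  have key := integral_add_le_two_mul_of_isLUB_one (hu.const_mul α⁻¹) (hv.const_mul β⁻¹)
    (hw.const_mul γ⁻¹) (hum.const_mul _) (hvm.const_mul _)
    (fun x => mul_nonneg (by positivity) (hu0 x)) (fun x => mul_nonneg (by positivity) (hv0 x))
    (fun x => mul_nonneg (by positivity) (hw0 x)) (lub u α hαp hα) (lub v β hβp hβ) (by
      intro a b
      rw [mul_pow, inv_pow, hγ]
      calc α⁻¹ * u a * (β⁻¹ * v b) = (α * β)⁻¹ * (u a * v b) := by field_simp
        _ ≤ _ := by gcongr; exact h a b)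
  rw [integral_const_mul, integral_const_mul, integral_const_mul] at key
  have hU : 0 ≤ ∫ x, u x := integral_nonneg hu0
  have hV : 0 ≤ ∫ x, v x := integral_nonneg hv0
  have hW : 0 ≤ ∫ x, w x := integral_nonneg hw0
  set U := ∫ x, u x
  set V := ∫ x, v x
  set W := ∫ x, w x
  have h1 : (α⁻¹ * U) * (β⁻¹ * V) ≤ (γ⁻¹ * W) ^ 2 := by
    have : 0 ≤ α⁻¹ * U := by positivity
    have : 0 ≤ β⁻¹ * V := by positivity
    have : 0 ≤ γ⁻¹ * W := by positivity
    nlinarith [sq_nonneg (α⁻¹ * U - β⁻¹ * V)]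
  calc U * V = α * β * ((α⁻¹ * U) * (β⁻¹ * V)) := by field_simp
    _ ≤ α * β * (γ⁻¹ * W) ^ 2 := by gcongr
    _ = W ^ 2 := by rw [← hγ]; field_simp

/-! ### Tame functions and the half-line Santaló inequality -/

theorem integral_Ioi_eq_integral_exp (φ : ℝ → ℝ) :
    ∫ s in Ioi (0 : ℝ), φ s = ∫ a, Real.exp a * φ (Real.exp a) := by
  have := integral_image_eq_integral_abs_deriv_smul (s := univ) (f := Real.exp) (f' := Real.exp)
    MeasurableSet.univ (fun x _ => (Real.hasDerivAt_exp x).hasDerivWithinAt)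
    Real.exp_injective.injOn φ
  simpa [image_univ, Real.range_exp, abs_of_pos, Real.exp_pos] using this

theorem integrable_exp_mul_comp_exp {φ : ℝ → ℝ} (h : IntegrableOn φ (Ioi 0)) :
    Integrable fun a => Real.exp a * φ (Real.exp a) := by
  have := integrableOn_image_iff_integrableOn_abs_deriv_smul (s := univ) (f := Real.exp)
    (f' := Real.exp)
    MeasurableSet.univ (fun x _ => (Real.hasDerivAt_exp x).hasDerivWithinAt)
    Real.exp_injective.injOn φ
  simpa [image_univ, Real.range_exp, abs_of_pos, Real.exp_pos, h] using this

/-- A nonnegative bounded measurable function that vanishes outside a ball. -/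
structure IsTame {E : Type*} [NormedAddCommGroup E] [MeasurableSpace E] (f : E → ℝ) : Prop where
  measurable : Measurable f
  nonneg : ∀ x, 0 ≤ f x
  bound : ∃ C, ∀ x, f x ≤ C ∧ (C < ‖x‖ → f x = 0)

theorem IsTame.exists_bound {E : Type*} [NormedAddCommGroup E] [MeasurableSpace E] {f : E → ℝ}
    (hf : IsTame f) : ∃ C, 0 ≤ C ∧ (∀ x, f x ≤ C) ∧ ∀ x, C < ‖x‖ → f x = 0 := by
  obtain ⟨C, hC⟩ := hf.bound
  exact ⟨C, (hf.nonneg 0).trans (hC 0).1, fun x => (hC x).1, fun x => (hC x).2⟩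

theorem IsTame.of_bounds {E : Type*} [NormedAddCommGroup E] [MeasurableSpace E] {f : E → ℝ}
    (hm : Measurable f) (h0 : ∀ x, 0 ≤ f x) {C R : ℝ} (hC : ∀ x, f x ≤ C)
    (hR : ∀ x, R < ‖x‖ → f x = 0) : IsTame f :=
  ⟨hm, h0, max C R, fun x => ⟨(hC x).trans (le_max_left _ _),
    fun h => hR x ((le_max_right _ _).trans_lt h)⟩⟩

/-- Products of tame functions with continuous ones are integrable. -/
theorem IsTame.integrable_smul {E F : Type*} [NormedAddCommGroup E] [MeasurableSpace E]
    [BorelSpace E] [ProperSpace E] [NormedAddCommGroup F] [NormedSpace ℝ F]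
    [SecondCountableTopologyEither E F] {μ : Measure E}
    [IsFiniteMeasureOnCompacts μ] {f : E → ℝ} (hf : IsTame f) {g : E → F} (hg : Continuous g) :
    Integrable (fun x => f x • g x) μ := by
  obtain ⟨C, hC0, hC, hR⟩ := hf.exists_bound
  have hK := isCompact_closedBall (0 : E) C
  have h1 : IntegrableOn (fun x => f x • g x) (Metric.closedBall 0 C) μ := by
    refine Integrable.bdd_smul (C := C) ?_ ?_ ?_
    · exact hg.continuousOn.integrableOn_compact hK
    · exact hf.measurable.aestronglyMeasurable
    · exact ae_of_all _ fun x => by rw [Real.norm_of_nonneg (hf.nonneg x)]; exact hC x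
  refine (integrableOn_iff_integrable_of_support_subset ?_).1 h1
  intro x hx
  by_contra hx'
  exact hx (by simp [hR x (by simpa using hx')])

theorem IsTame.integrable {E : Type*} [NormedAddCommGroup E] [MeasurableSpace E]
    [BorelSpace E] [ProperSpace E] {μ : Measure E} [IsFiniteMeasureOnCompacts μ] {f : E → ℝ}
    (hf : IsTame f) : Integrable f μ := by
  simpa using hf.integrable_smul (μ := μ) (g := fun _ => (1 : ℝ)) continuous_const

theorem IsTame.bddAbove_exp_mul_comp_exp {φ : ℝ → ℝ} (hφ : IsTame φ) :
    BddAbove (range fun a => Real.exp a * φ (Real.exp a)) := by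
  obtain ⟨C, hC0, hC, hR⟩ := hφ.exists_bound
  refine ⟨C * C, ?_⟩
  rintro _ ⟨a, rfl⟩
  rcases le_or_gt (Real.exp a) C with h | h
  · exact mul_le_mul h (hC _) (hφ.nonneg _) hC0
  · simp only [hR (Real.exp a) (by rwa [Real.norm_of_nonneg (Real.exp_pos a).le]), mul_zero]
    positivity

/-- The functional Blaschke–Santaló inequality on the half line. -/
theorem integral_Ioi_mul_integral_Ioi_le {φ ψ : ℝ → ℝ} (hφ : IsTame φ) (hψ : IsTame ψ) {c : ℝ}
    (hc : 0 ≤ c) (h : ∀ s > 0, ∀ t > 0, φ s * ψ t ≤ c * Real.exp (-(s * t))) :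
    (∫ s in Ioi (0 : ℝ), φ s) * ∫ t in Ioi (0 : ℝ), ψ t ≤ c * (Real.pi / 2) := by
  -- With s = e^a and t = e^b, the point e^{(a+b)/2} is √(st), and ρ(√(st))² = c e^{-st}. The
  -- Jacobians e^a and e^b multiply to the square of the one at the midpoint.
  set ρ : ℝ → ℝ := fun r => √c * Real.exp (-(1 / 2) * r ^ 2) with hρ
  have hρi : IntegrableOn ρ (Ioi 0) :=
    ((integrable_exp_neg_mul_sq (by norm_num : (0 : ℝ) < 1 / 2)).const_mul _).integrableOn
  have hρv : (∫ r in Ioi (0 : ℝ), ρ r) ^ 2 = c * (Real.pi / 2) := by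
    rw [hρ, integral_const_mul, integral_gaussian_Ioi, mul_pow, Real.sq_sqrt hc, div_pow,
      Real.sq_sqrt (by positivity)]
    ring
  rw [← hρv, integral_Ioi_eq_integral_exp φ, integral_Ioi_eq_integral_exp ψ,
    integral_Ioi_eq_integral_exp ρ]
  refine prekopa_leindler_real (integrable_exp_mul_comp_exp hφ.integrable.integrableOn)
    (integrable_exp_mul_comp_exp hψ.integrable.integrableOn) (integrable_exp_mul_comp_exp hρi)
    (Real.measurable_exp.mul (hφ.measurable.comp Real.measurable_exp))
    (Real.measurable_exp.mul (hψ.measurable.comp Real.measurable_exp))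
    (fun a => mul_nonneg (Real.exp_pos a).le (hφ.nonneg _))
    (fun a => mul_nonneg (Real.exp_pos a).le (hψ.nonneg _)) (fun a => by positivity)
    hφ.bddAbove_exp_mul_comp_exp hψ.bddAbove_exp_mul_comp_exp fun a b => ?_
  have e : Real.exp ((a + b) / 2) ^ 2 = Real.exp a * Real.exp b := by
    rw [← Real.exp_add, ← Real.exp_nat_mul]; push_cast; congr 1; ring
  calc Real.exp a * φ (Real.exp a) * (Real.exp b * ψ (Real.exp b))
      = Real.exp a * Real.exp b * (φ (Real.exp a) * ψ (Real.exp b)) := by ring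
    _ ≤ Real.exp a * Real.exp b * (c * Real.exp (-(Real.exp a * Real.exp b))) := by
        exact mul_le_mul_of_nonneg_left (h _ (Real.exp_pos a) _ (Real.exp_pos b)) (by positivity)
    _ = (Real.exp ((a + b) / 2) * ρ (Real.exp ((a + b) / 2))) ^ 2 := by
        simp only [hρ, mul_pow, e, Real.sq_sqrt hc, ← Real.exp_nat_mul]
        push_cast
        congr 3
        ring

/-- Where f ∘ φ does not vanish, x = ψ (φ x) lies in the image under ψ of a closed ball, which is
bounded since ψ is continuous. -/
theorem IsTame.comp {E F : Type*} [NormedAddCommGroup E] [MeasurableSpace E] [ProperSpace E]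
    [NormedAddCommGroup F] [MeasurableSpace F] {f : E → ℝ} (hf : IsTame f) {φ : F → E} {ψ : E → F}
    (hφ : Measurable φ) (hψ : Continuous ψ) (h : Function.LeftInverse ψ φ) :
    IsTame fun x => f (φ x) := by
  obtain ⟨C, hC0, hC, hR⟩ := hf.exists_bound
  obtain ⟨R, hRb⟩ := ((isCompact_closedBall (0 : E) C).image hψ).isBounded.exists_norm_le
  refine .of_bounds (hf.measurable.comp hφ) (fun x => hf.nonneg _) (fun x => hC _) (R := R)
    fun x hx => hR _ ?_
  by_contra! hx'
  have := hRb (ψ (φ x)) ⟨φ x, by simpa using hx', rfl⟩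
  rw [h x] at this
  linarith

theorem IsTame.mul_continuous {E : Type*} [NormedAddCommGroup E] [MeasurableSpace E]
    [OpensMeasurableSpace E] [ProperSpace E] {f : E → ℝ} (hf : IsTame f) {g : E → ℝ}
    (hg : Continuous g) (hg0 : ∀ x, 0 ≤ g x) : IsTame fun x => f x * g x := by
  obtain ⟨C, hC0, hC, hR⟩ := hf.exists_bound
  obtain ⟨D, hD⟩ := ((isCompact_closedBall (0 : E) C).image hg).isBounded.exists_norm_le
  refine .of_bounds (hf.measurable.mul hg.measurable) (fun x => mul_nonneg (hf.nonneg x) (hg0 x))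
    (C := C * max D 0) (R := C) (fun x => ?_) fun x hx => by rw [hR x hx, zero_mul]
  rcases le_or_gt ‖x‖ C with h | h
  · have h1 : g x ≤ D := (le_abs_self _).trans (hD (g x) ⟨x, by simpa using h, rfl⟩)
    exact mul_le_mul (hC x) (h1.trans (le_max_left _ _)) (hg0 x) hC0
  · rw [hR x h, zero_mul]; positivity

theorem IsTame.const_mul {E : Type*} [NormedAddCommGroup E] [MeasurableSpace E]
    {f : E → ℝ} (hf : IsTame f) {c : ℝ} (hc : 0 ≤ c) : IsTame fun x => c * f x := by
  obtain ⟨C, hC0, hC, hR⟩ := hf.exists_bound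
  exact .of_bounds (hf.measurable.const_mul c) (fun x => mul_nonneg hc (hf.nonneg x))
    (C := c * C) (R := C) (fun x => mul_le_mul_of_nonneg_left (hC x) hc)
    fun x hx => by rw [hR x hx, mul_zero]

/-! ### Functional Santaló inequality on ℝⁿ, by induction on n -/

section Slices

variable {E F : Type*} [NormedAddCommGroup E] [MeasurableSpace E] [NormedAddCommGroup F]
  [MeasurableSpace F]

theorem IsTame.slice {f : E × F → ℝ} (hf : IsTame f) (y : F) : IsTame fun s => f (s, y) := by
  obtain ⟨C, hC0, hC, hR⟩ := hf.exists_bound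
  exact .of_bounds (hf.measurable.comp (by fun_prop)) (fun x => hf.nonneg _) (fun x => hC _)
    (R := C) fun x hx => hR _ (hx.trans_le (norm_fst_le (x, y)))

theorem IsTame.integral_slice [BorelSpace E] [ProperSpace E] {f : E × F → ℝ} (hf : IsTame f)
    (μ : Measure E) [SFinite μ] [IsFiniteMeasureOnCompacts μ] :
    IsTame fun y => ∫ s, f (s, y) ∂μ := by
  obtain ⟨C, hC0, hC, hR⟩ := hf.exists_bound
  refine .of_bounds ?_ (fun y => integral_nonneg fun s => hf.nonneg _)
    (C := C * μ.real (Metric.closedBall 0 C)) (R := C) (fun y => ?_) fun y hy => ?_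
  · exact (hf.measurable.stronglyMeasurable.integral_prod_left' (μ := μ)).measurable
  · have h1 : ∫ s, f (s, y) ∂μ = ∫ s in Metric.closedBall 0 C, f (s, y) ∂μ := by
      refine (setIntegral_eq_integral_of_forall_compl_eq_zero fun s hs => hR _ ?_).symm
      exact lt_of_lt_of_le (by simpa using hs) (norm_fst_le (s, y))
    rw [h1]
    have h2 := norm_setIntegral_le_of_norm_le_const (μ := μ) (f := fun s => f (s, y)) (C := C)
      (s := Metric.closedBall 0 C) measure_closedBall_lt_top
      (fun s _ => by rw [Real.norm_of_nonneg (hf.nonneg _)]; exact hC _)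
    exact (le_abs_self _).trans h2
  · have : ∀ s, f (s, y) = 0 := fun s => hR _ (hy.trans_le (norm_snd_le (s, y)))
    simp [this]

end Slices

/-- The functional Blaschke–Santaló inequality for tame functions on `ℝⁿ`, one of which has its
barycenter at the origin. -/
def FunctionalSantalo (n : ℕ) : Prop :=
  ∀ f g : (Fin n → ℝ) → ℝ, IsTame f → IsTame g → (∀ i, ∫ x, f x * x i = 0) →
    (∀ x y, f x * g y ≤ Real.exp (-(x ⬝ᵥ y))) →
    (∫ x, f x) * ∫ y, g y ≤ (2 * Real.pi) ^ n

variable {n : ℕ}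

theorem setIntegral_Ioi_prod {f : ℝ × (Fin n → ℝ) → ℝ} (hf : Integrable f) :
    ∫ p in Ioi 0 ×ˢ univ, f p = ∫ y, ∫ s in Ioi 0, f (s, y) := by
  rw [Measure.volume_eq_prod, ← Measure.prod_restrict, Measure.restrict_univ, integral_prod_symm]
  have := hf.restrict (s := Ioi 0 ×ˢ univ)
  rwa [Measure.volume_eq_prod, ← Measure.prod_restrict, Measure.restrict_univ] at this

/-- For fixed y and y', the half-line inequality with c = e^{-⟨y, y'⟩} shows that the integrals over
the first coordinate satisfy the n-dimensional hypothesis up to the factor π/2. The moment condition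
says exactly that the first marginal has its barycenter at 0. -/
theorem FunctionalSantalo.half_space (H : FunctionalSantalo n) {f k : ℝ × (Fin n → ℝ) → ℝ}
    (hf : IsTame f) (hk : IsTame k) (h0 : ∀ i, ∫ p in Ioi 0 ×ˢ univ, f p * p.2 i = 0)
    (h : ∀ p q, f p * k q ≤ Real.exp (-(p.1 * q.1 + p.2 ⬝ᵥ q.2))) :
    (∫ p in Ioi 0 ×ˢ univ, f p) * ∫ p in Ioi 0 ×ˢ univ, k p
      ≤ Real.pi / 2 * (2 * Real.pi) ^ n := by
  have hF := hf.integral_slice (volume.restrict (Ioi 0))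
  have hG := hk.integral_slice (volume.restrict (Ioi 0))
  have hpi := Real.pi_pos
  have key := H _ _ hF (hG.const_mul (c := 2 / Real.pi) (by positivity)) (fun i => ?_) ?_
  · rw [integral_const_mul] at key
    rw [setIntegral_Ioi_prod hf.integrable, setIntegral_Ioi_prod hk.integrable]
    calc _ = Real.pi / 2 * ((∫ y, ∫ s in Ioi 0, f (s, y)) *
        (2 / Real.pi * ∫ y, ∫ s in Ioi 0, k (s, y))) := by field_simp
      _ ≤ _ := by gcongr
  · refine Eq.trans ?_ (h0 i)
    rw [setIntegral_Ioi_prod]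
    · simp only [integral_mul_const]
    · exact hf.integrable_smul (g := fun p => p.2 i) (by fun_prop)
  · intro x y
    have := integral_Ioi_mul_integral_Ioi_le (hf.slice x) (hk.slice y)
      (Real.exp_pos (-(x ⬝ᵥ y))).le fun s _ t _ => by
        rw [← Real.exp_add]
        convert h (s, x) (t, y) using 2
        ring
    calc _ = 2 / Real.pi * ((∫ s in Ioi 0, f (s, x)) * ∫ s in Ioi 0, k (s, y)) := by ring
      _ ≤ 2 / Real.pi * (Real.exp (-(x ⬝ᵥ y)) * (Real.pi / 2)) := by gcongr
      _ = _ := by field_simp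

/-- The reflection of the first coordinate. -/
def reflectFst (p : ℝ × (Fin n → ℝ)) : ℝ × (Fin n → ℝ) := (-p.1, p.2)

theorem continuous_reflectFst : Continuous (reflectFst (n := n)) := by
  unfold reflectFst; fun_prop

theorem IsTame.reflectFst {f : ℝ × (Fin n → ℝ) → ℝ} (hf : IsTame f) :
    IsTame fun p => f (reflectFst p) :=
  hf.comp continuous_reflectFst.measurable continuous_reflectFst
    fun p => by simp [_root_.reflectFst]

theorem integral_eq_setIntegral_add_reflectFst {f : ℝ × (Fin n → ℝ) → ℝ} (hf : IsTame f) :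
    ∫ p, f p = (∫ p in Ioi 0 ×ˢ univ, f p) + ∫ p in Ioi 0 ×ˢ univ, f (reflectFst p) := by
  rw [setIntegral_Ioi_prod hf.integrable, setIntegral_Ioi_prod hf.reflectFst.integrable,
    ← integral_add (hf.integral_slice (volume.restrict (Ioi 0))).integrable
      (hf.reflectFst.integral_slice (volume.restrict (Ioi 0))).integrable,
    Measure.volume_eq_prod, integral_prod_symm _ hf.integrable]
  refine integral_congr_ae (ae_of_all _ fun y => ?_)
  have hi := (hf.slice y).integrable (μ := volume)
  simp only [reflectFst]
  rw [integral_comp_neg_Ioi (c := 0) (f := fun s => f (s, y)), neg_zero, add_comm]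
  exact (intervalIntegral.integral_Iic_add_Ioi hi.integrableOn hi.integrableOn).symm

/-- If M is the common mass of the two halves of f, and k has masses K₊ and K₋ there, the half-space
bounds add up to M (K₊ + K₋) ≤ π (2π)^n. Doubling gives the claim, because f has mass 2M. -/
theorem FunctionalSantalo.of_bisected (H : FunctionalSantalo n) {f k : ℝ × (Fin n → ℝ) → ℝ}
    (hf : IsTame f) (hk : IsTame k) (h0 : ∀ i, ∫ p in Ioi 0 ×ˢ univ, f p * p.2 i = 0)
    (h0' : ∀ i, ∫ p in Ioi 0 ×ˢ univ, f (reflectFst p) * p.2 i = 0)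
    (hM : ∫ p in Ioi 0 ×ˢ univ, f p = ∫ p in Ioi 0 ×ˢ univ, f (reflectFst p))
    (h : ∀ p q, f p * k q ≤ Real.exp (-(p.1 * q.1 + p.2 ⬝ᵥ q.2))) :
    (∫ p, f p) * ∫ p, k p ≤ (2 * Real.pi) ^ (n + 1) := by
  have h1 := H.half_space hf hk h0 h
  have h2 := H.half_space hf.reflectFst hk.reflectFst h0' fun p q => by
    simpa [reflectFst] using h (reflectFst p) (reflectFst q)
  rw [integral_eq_setIntegral_add_reflectFst hf, integral_eq_setIntegral_add_reflectFst hk, pow_succ]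
  rw [← hM] at h2 ⊢
  linarith

theorem exists_setIntegral_Iic_eq_Ioi {H : ℝ → ℝ} (hH : IsTame H) :
    ∃ m, ∫ s in Iic m, H s = ∫ s in Ioi m, H s := by
  obtain ⟨C, hC0, hC, hR⟩ := hH.exists_bound
  have hi : Integrable H := hH.integrable
  have hadd : ∀ m, (∫ s in Iic m, H s) + ∫ s in Ioi m, H s = ∫ s, H s := fun m =>
    intervalIntegral.integral_Iic_add_Ioi hi.integrableOn hi.integrableOn
  have hpos : 0 ≤ ∫ s, H s := integral_nonneg hH.nonneg
  have hcont : Continuous fun m => ∫ s in Iic m, H s := by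
    have : (fun m => ∫ s in Iic m, H s) = fun m => (∫ s in Iic 0, H s) + ∫ s in (0)..m, H s := by
      funext m
      rw [← intervalIntegral.integral_Iic_sub_Iic hi.integrableOn hi.integrableOn]
      ring
    rw [this]
    exact continuous_const.add (intervalIntegral.continuous_primitive
      (fun a b => hi.intervalIntegrable) 0)
  have hlo : ∫ s in Iic (-(C + 1)), H s = 0 :=
    setIntegral_eq_zero_of_forall_eq_zero fun s (hs : s ≤ _) => hR s (by
      rw [Real.norm_eq_abs, abs_of_nonpos (by linarith)]; linarith)
  have hhi : ∫ s in Ioi (C + 1), H s = 0 :=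
    setIntegral_eq_zero_of_forall_eq_zero fun s (hs : _ < s) => hR s (by
      rw [Real.norm_eq_abs, abs_of_nonneg (by linarith)]; linarith)
  obtain ⟨m, -, hm⟩ := intermediate_value_Icc (a := -(C + 1)) (b := C + 1) (by linarith)
    hcont.continuousOn (show (∫ s, H s) / 2 ∈ _ by
      constructor
      · rw [hlo]; linarith
      · have := hadd (C + 1); rw [hhi] at this; linarith)
  exact ⟨m, by have := hadd m; simp only at hm; linarith⟩

/-- The shear `(s, y) ↦ (a + s, z + y + s w)`. -/
def affineShear (a : ℝ) (z w : Fin n → ℝ) : ℝ × (Fin n → ℝ) ≃ₜ ℝ × (Fin n → ℝ) where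
  toFun p := (a + p.1, z + p.2 + p.1 • w)
  invFun p := (p.1 - a, p.2 - z - (p.1 - a) • w)
  left_inv p := by ext <;> simp; ring
  right_inv p := by ext <;> simp; ring
  continuous_toFun := by fun_prop
  continuous_invFun := by fun_prop

theorem measurePreserving_affineShear (a : ℝ) (z w : Fin n → ℝ) :
    MeasurePreserving (affineShear a z w) := by
  refine MeasurePreserving.skew_product (g := fun s y => z + y + s • w)
    (measurePreserving_add_left volume a) (by fun_prop) (ae_of_all _ fun s => ?_)
  have := ((measurePreserving_add_right volume (s • w)).comp
    (measurePreserving_add_left volume z)).map_eq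
  exact this

theorem IsTame.comp_affineShear {f : ℝ × (Fin n → ℝ) → ℝ} (hf : IsTame f) (a : ℝ)
    (z w : Fin n → ℝ) : IsTame fun p => f (affineShear a z w p) :=
  hf.comp (affineShear a z w).continuous.measurable (affineShear a z w).symm.continuous
    (affineShear a z w).left_inv

theorem setIntegral_comp_affineShear (z w : Fin n → ℝ) (f : ℝ × (Fin n → ℝ) → ℝ) :
    ∫ p in Ioi 0 ×ˢ univ, f (affineShear 0 z w p) = ∫ p in Ioi 0 ×ˢ univ, f p := by
  rw [← (measurePreserving_affineShear 0 z w).setIntegral_preimage_emb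
    (affineShear 0 z w).measurableEmbedding f]
  congr 2
  ext p
  simp [affineShear]

/-- Ensures that the slope of the shear in `exists_center` has a nonzero denominator. -/
theorem setIntegral_pos_of_fst_mul {f : ℝ × (Fin n → ℝ) → ℝ} (hf : IsTame f)
    (hM : 0 < ∫ p in Ioi 0 ×ˢ univ, f p) : 0 < ∫ p in Ioi 0 ×ˢ univ, f p * p.1 := by
  have hm : MeasurableSet ((Ioi 0 : Set ℝ) ×ˢ (univ : Set (Fin n → ℝ))) :=
    measurableSet_Ioi.prod .univ
  have hnn : ∀ p ∈ (Ioi 0 : Set ℝ) ×ˢ (univ : Set (Fin n → ℝ)), 0 ≤ f p * p.1 :=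
    fun p hp => mul_nonneg (hf.nonneg p) (le_of_lt hp.1)
  refine (setIntegral_nonneg hm hnn).lt_of_ne' fun h0 => hM.ne' ?_
  rw [setIntegral_eq_zero_iff_of_nonneg_ae ((ae_restrict_iff' hm).2 (ae_of_all _ hnn))
    (hf.integrable_smul (g := Prod.fst) (by fun_prop)).integrableOn] at h0
  refine integral_eq_zero_of_ae ?_
  filter_upwards [h0, ae_restrict_mem hm] with p hp hp'
  simpa [(show 0 < p.1 from hp'.1).ne'] using hp

/-- The center is the point where the line through the barycenters of the two halves of h meets the
bisecting hyperplane. It depends on h alone, which matters because the k it is later applied to is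
built from z. -/
theorem FunctionalSantalo.exists_center (H : FunctionalSantalo n) {h : ℝ × (Fin n → ℝ) → ℝ}
    (hh : IsTame h) (hM : 0 < ∫ p, h p) :
    ∃ z : ℝ × (Fin n → ℝ), ∀ k : ℝ × (Fin n → ℝ) → ℝ, IsTame k →
      (∀ p q, h (z + p) * k q ≤ Real.exp (-(p.1 * q.1 + p.2 ⬝ᵥ q.2))) →
      (∫ p, h p) * ∫ p, k p ≤ (2 * Real.pi) ^ (n + 1) := by
  obtain ⟨m, hm⟩ := exists_setIntegral_Iic_eq_Ioi
    (hh.comp (φ := Prod.swap) measurable_swap continuous_swap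
      (fun p => Prod.swap_swap p) |>.integral_slice (volume : Measure (Fin n → ℝ)))
  simp only [Prod.swap_prod_mk] at hm
  set hp : ℝ × (Fin n → ℝ) → ℝ := fun p => h (affineShear m 0 0 p) with hhp
  have hpt : IsTame hp := hh.comp_affineShear m 0 0
  have hpM : ∫ p, hp p = ∫ p, h p :=
    (measurePreserving_affineShear m 0 0).integral_comp (affineShear m 0 0).measurableEmbedding h
  have hbis : ∫ p in Ioi 0 ×ˢ univ, hp p = ∫ p in Ioi 0 ×ˢ univ, hp (reflectFst p) := by
    have e : ∀ {f : ℝ × (Fin n → ℝ) → ℝ}, IsTame f →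
        ∫ p in Ioi 0 ×ˢ univ, f p = ∫ s in Ioi 0, ∫ y, f (s, y) := fun hf => by
      rw [Measure.volume_eq_prod, setIntegral_prod]
      · simp
      · exact hf.integrable.integrableOn
    rw [e hpt, e hpt.reflectFst]
    simp only [hhp, affineShear, reflectFst, Homeomorph.homeomorph_mk_coe, Equiv.coe_fn_mk,
      zero_add, smul_zero, add_zero]
    rw [integral_comp_neg_Ioi (c := 0) (f := fun s => ∫ y, h (m + s, y))]
    have e1 := (measurePreserving_add_left volume m).setIntegral_preimage_emb
      (MeasurableEquiv.addLeft m).measurableEmbedding (fun s => ∫ y, h (s, y)) (Ioi m)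
    have e2 := (measurePreserving_add_left volume m).setIntegral_preimage_emb
      (MeasurableEquiv.addLeft m).measurableEmbedding (fun s => ∫ y, h (s, y)) (Iic m)
    rw [← e1, ← e2] at hm
    simpa using hm.symm
  have hhalf : ∫ p, hp p = 2 * ∫ p in Ioi 0 ×ˢ univ, hp p := by
    rw [integral_eq_setIntegral_add_reflectFst hpt, ← hbis]; ring
  set M := ∫ p in Ioi 0 ×ˢ univ, hp p with hMdef
  have hM0 : 0 < M := by linarith
  have hS := setIntegral_pos_of_fst_mul hpt hM0
  have hS' := setIntegral_pos_of_fst_mul hpt.reflectFst (hbis ▸ hM0)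
  set S := ∫ p in Ioi 0 ×ˢ univ, hp p * p.1 with hSdef
  set S' := ∫ p in Ioi 0 ×ˢ univ, hp (reflectFst p) * p.1 with hSdef'
  set Y : Fin n → ℝ := fun i => ∫ p in Ioi 0 ×ˢ univ, hp p * p.2 i with hY
  set Y' : Fin n → ℝ := fun i => ∫ p in Ioi 0 ×ˢ univ, hp (reflectFst p) * p.2 i with hY'
  -- The barycenters of the sheared halves lie on the first axis when Y = z M + w S and Y' = z M - w
  -- S'. Subtracting gives w, and then the first equation gives z.
  set w : Fin n → ℝ := fun i => (Y i - Y' i) / (S + S') with hw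
  set z : Fin n → ℝ := fun i => (Y i - w i * S) / M with hz
  have hwS : ∀ i, w i * (S + S') = Y i - Y' i := fun i => div_mul_cancel₀ _ (by positivity)
  have hzM : ∀ i, z i * M = Y i - w i * S := fun i => div_mul_cancel₀ _ hM0.ne'
  have expand : ∀ {f : ℝ × (Fin n → ℝ) → ℝ}, IsTame f → ∀ (v : Fin n → ℝ) (i : Fin n),
      ∫ p in Ioi 0 ×ˢ univ, f (affineShear 0 z v p) * p.2 i =
        (∫ p in Ioi 0 ×ˢ univ, f p * p.2 i) - z i * (∫ p in Ioi 0 ×ˢ univ, f p)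
          - v i * ∫ p in Ioi 0 ×ˢ univ, f p * p.1 := by
    intro f hf v i
    have e := setIntegral_comp_affineShear z v (fun p => f p * (p.2 i - z i - p.1 * v i))
    have e' : ∀ p, f (affineShear 0 z v p) * ((affineShear 0 z v p).2 i - z i
        - (affineShear 0 z v p).1 * v i) = f (affineShear 0 z v p) * p.2 i := fun p => by
      simp only [affineShear, Homeomorph.homeomorph_mk_coe, Equiv.coe_fn_mk, Pi.add_apply,
        Pi.smul_apply, smul_eq_mul, zero_add]
      ring
    simp only [e'] at e
    rw [e, ← integral_const_mul, ← integral_const_mul, ← integral_sub, ← integral_sub]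
    · congr 1 with p; ring
    · exact ((hf.integrable_smul (g := fun p => p.2 i) (by fun_prop)).integrableOn.sub
        (hf.integrable.integrableOn.const_mul _))
    · exact ((hf.integrable_smul (g := fun p => p.1) (by fun_prop)).integrableOn.const_mul _)
    · exact (hf.integrable_smul (g := fun p => p.2 i) (by fun_prop)).integrableOn
    · exact hf.integrable.integrableOn.const_mul _
  -- Reflecting the first coordinate reverses the slope of the shear.
  have hrefl : ∀ p, hp (affineShear 0 z w (reflectFst p)) =
      (fun q => hp (reflectFst q)) (affineShear 0 z (-w) p) := fun p => by
    simp [affineShear, reflectFst]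
  refine ⟨(m, z), fun k hk hineq => ?_⟩
  -- The inverse transpose of the shear acts on the dual variable: it preserves the pairing and the
  -- integral of k.
  set k' : ℝ × (Fin n → ℝ) → ℝ := fun q => k (q.1 - w ⬝ᵥ q.2, q.2) with hk'
  have hk't : IsTame k' := hk.comp (φ := fun q => (q.1 - w ⬝ᵥ q.2, q.2))
    (ψ := fun q => (q.1 + w ⬝ᵥ q.2, q.2)) (by simp only [dotProduct]; fun_prop)
    (by simp only [dotProduct]; fun_prop) (fun q => by simp)
  have hk'i : ∫ q, k' q = ∫ q, k q := by
    rw [Measure.volume_eq_prod, integral_prod_symm _ hk't.integrable,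
      integral_prod_symm _ hk.integrable]
    congr 1 with y
    exact integral_sub_right_eq_self (fun t => k (t, y)) (w ⬝ᵥ y)
  have hpt' : IsTame fun p => hp (affineShear 0 z w p) := hpt.comp_affineShear 0 z w
  have hpi' : ∫ p, hp (affineShear 0 z w p) = ∫ p, hp p :=
    (measurePreserving_affineShear 0 z w).integral_comp (affineShear 0 z w).measurableEmbedding hp
  have key := H.of_bisected hpt' hk't (fun i => ?_) (fun i => ?_) ?_ fun p q => ?_
  · rwa [hk'i, hpi', hpM] at key
  · rw [expand hpt]
    linarith [hzM i]
  · simp only [hrefl]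
    rw [expand hpt.reflectFst, ← hbis]
    simp only [Pi.neg_apply]
    linarith [hzM i, hwS i]
  · simp only [hrefl]
    rw [setIntegral_comp_affineShear, setIntegral_comp_affineShear (f := fun q => hp (reflectFst q)),
      ← hbis]
  · have := hineq (p.1, p.2 + p.1 • w) (q.1 - w ⬝ᵥ q.2, q.2)
    convert this using 2
    · simp [hhp, affineShear, add_assoc]
    · simp only [add_dotProduct, smul_dotProduct, smul_eq_mul]
      ring

/-- Recentering g at z costs the factor e^{ℓ} on f, where ℓ(p) = ⟨p, z⟩. The cost has the right
sign: e^ℓ ≥ 1 + ℓ and ∫ f ℓ = 0, so the mass of f can only grow. -/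
theorem FunctionalSantalo.prod (H : FunctionalSantalo n) {f g : ℝ × (Fin n → ℝ) → ℝ}
    (hf : IsTame f) (hg : IsTame g) (h1 : ∫ p, f p * p.1 = 0)
    (h2 : ∀ i, ∫ p, f p * p.2 i = 0)
    (h : ∀ p q, f p * g q ≤ Real.exp (-(p.1 * q.1 + p.2 ⬝ᵥ q.2))) :
    (∫ p, f p) * ∫ p, g p ≤ (2 * Real.pi) ^ (n + 1) := by
  rcases (integral_nonneg (μ := volume) (f := g) hg.nonneg).eq_or_lt with h0 | h0
  · rw [← h0, mul_zero]
    positivity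
  obtain ⟨z, hz⟩ := H.exists_center hg h0
  set ℓ : ℝ × (Fin n → ℝ) → ℝ := fun p => p.1 * z.1 + p.2 ⬝ᵥ z.2 with hℓ
  have hℓc : Continuous ℓ := by simp only [hℓ, dotProduct]; fun_prop
  have hft : IsTame fun p => f p * Real.exp (ℓ p) :=
    hf.mul_continuous (by fun_prop) fun p => (Real.exp_pos _).le
  have key := hz _ hft fun p q => by
    have := h q (z + p)
    calc g (z + p) * (f q * Real.exp (ℓ q)) = f q * g (z + p) * Real.exp (ℓ q) := by ring
      _ ≤ Real.exp (-(q.1 * (z + p).1 + q.2 ⬝ᵥ (z + p).2)) * Real.exp (ℓ q) := by gcongr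
      _ = _ := by
        rw [← Real.exp_add]
        congr 1
        simp only [hℓ, Prod.fst_add, Prod.snd_add, dotProduct_add, dotProduct_comm p.2]
        ring
  have hle : ∫ p, f p ≤ ∫ p, f p * Real.exp (ℓ p) := by
    have hint : ∫ p, f p * ℓ p = 0 := by
      have e : ∀ p : ℝ × (Fin n → ℝ), f p * ℓ p
          = f p * p.1 * z.1 + ∑ i, f p * p.2 i * z.2 i := fun p => by
        simp only [hℓ, dotProduct, mul_add, Finset.mul_sum, mul_assoc]
      simp only [e]
      rw [integral_add, integral_finsetSum]
      · simp [integral_mul_const, h1, h2]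
      · exact fun i _ => (hf.integrable_smul (g := fun p => p.2 i) (by fun_prop)).mul_const _
      · exact (hf.integrable_smul (g := fun p => p.1) (by fun_prop)).mul_const _
      · exact integrable_finsetSum _ fun i _ =>
          (hf.integrable_smul (g := fun p => p.2 i) (by fun_prop)).mul_const _
    have hi : Integrable fun p => f p * ℓ p := hf.integrable_smul hℓc
    calc ∫ p, f p = ∫ p, (f p + f p * ℓ p) := by
          rw [integral_add hf.integrable hi, hint, add_zero]
      _ ≤ _ := by
          refine integral_mono (hf.integrable.add hi) hft.integrable
            fun p => ?_
          have := Real.add_one_le_exp (ℓ p)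
          have := hf.nonneg p
          simp only
          nlinarith
  calc _ ≤ (∫ p, f p * Real.exp (ℓ p)) * ∫ p, g p := by gcongr
    _ ≤ _ := by rwa [mul_comm]

theorem functionalSantalo (n : ℕ) : FunctionalSantalo n := by
  induction n with
  | zero =>
    intro f g hf hg _ h
    have e : ∀ f : (Fin 0 → ℝ) → ℝ, ∫ x, f x = f 0 := fun f => by
      rw [Measure.volume_pi_eq_dirac 0, integral_dirac]
    rw [e, e]
    simpa using h 0 0
  | succ n ih =>
    intro f g hf hg h0 h
    set e := (MeasurableEquiv.piFinSuccAbove (fun _ : Fin (n + 1) => ℝ) 0).symm with he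
    have hmp : MeasurePreserving e :=
      (volume_preserving_piFinSuccAbove (fun _ : Fin (n + 1) => ℝ) 0).symm
    have hval : ∀ p : ℝ × (Fin n → ℝ), e p = Fin.cons p.1 p.2 := fun p => by
      simp [he, MeasurableEquiv.piFinSuccAbove]
      rfl
    have htame : ∀ {f : (Fin (n + 1) → ℝ) → ℝ}, IsTame f → IsTame fun p => f (e p) := fun hf =>
      hf.comp (ψ := fun x => (x 0, Fin.tail x)) e.measurable
        (by unfold Fin.tail; fun_prop) fun p => by simp [hval]
    have hint : ∀ f : (Fin (n + 1) → ℝ) → ℝ, ∫ p, f (e p) = ∫ x, f x := fun f =>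
      hmp.integral_comp e.measurableEmbedding f
    rw [← hint f, ← hint g]
    refine ih.prod (htame hf) (htame hg) ?_ (fun i => ?_) fun p q => ?_
    · rw [← h0 0, ← hint]
      simp [hval]
    · rw [← h0 i.succ, ← hint]
      simp [hval]
    · convert h (e p) (e q) using 3
      simp [dotProduct, hval, Fin.sum_univ_succ]

theorem integral_mul_integral_le_of_barycenter_eq_zero {d : ℕ} {f g : EuclideanSpace ℝ (Fin d) → ℝ}
    (hf : IsTame f) (hg : IsTame g) (h0 : ∀ i, ∫ x, f x * x i = 0)
    (h : ∀ x y, f x * g y ≤ Real.exp (-inner ℝ x y)) :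
    (∫ x, f x) * ∫ y, g y ≤ (2 * Real.pi) ^ d := by
  have hint : ∀ f : EuclideanSpace ℝ (Fin d) → ℝ, ∫ x, f (WithLp.toLp 2 x) = ∫ x, f x := fun f =>
    (PiLp.volume_preserving_toLp (Fin d)).integral_comp
      (MeasurableEquiv.toLp 2 (Fin d → ℝ)).measurableEmbedding f
  have htame : ∀ {f : EuclideanSpace ℝ (Fin d) → ℝ}, IsTame f →
      IsTame fun x : Fin d → ℝ => f (WithLp.toLp 2 x) := fun hf =>
    hf.comp (MeasurableEquiv.toLp 2 (Fin d → ℝ)).measurable (PiLp.continuous_ofLp 2 _)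
      fun x => rfl
  rw [← hint f, ← hint g]
  refine functionalSantalo d _ _ (htame hf) (htame hg) (fun i => ?_) fun x y => ?_
  · rw [← h0 i, ← hint]
  · convert h (WithLp.toLp 2 x) (WithLp.toLp 2 y) using 3
    simp [PiLp.inner_apply, dotProduct, mul_comm]

/-! ### From functions to sublevel sets of homogeneous functions -/

section Layer

variable {d : ℕ} {p : EuclideanSpace ℝ (Fin d) → ℝ} {r R : ℝ}

/-- The kernel `(t, x) ↦ t e^{-t²/2}` restricted to `p x ≤ t` and `0 < t ≤ R`. -/
noncomputable def layerKernel (p : EuclideanSpace ℝ (Fin d) → ℝ) (R : ℝ)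
    (q : ℝ × EuclideanSpace ℝ (Fin d)) : ℝ :=
  Set.indicator {q : ℝ × EuclideanSpace ℝ (Fin d) | p q.2 ≤ q.1 ∧ q.1 ∈ Ioc 0 R}
    (fun q => q.1 * Real.exp (-(1 / 2) * q.1 ^ 2)) q

/-- A truncation of `e^{-p²/2}` at `p = R`, written as a superposition of indicators of sublevel
sets of `p`. -/
noncomputable def layer (p : EuclideanSpace ℝ (Fin d) → ℝ) (R : ℝ)
    (x : EuclideanSpace ℝ (Fin d)) : ℝ :=
  ∫ t, layerKernel p R (t, x)

theorem isTame_layerKernel (hp : Measurable p) (hr : 0 < r) (hb : ∀ x, r * ‖x‖ ≤ p x) (hR : 0 ≤ R) :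
    IsTame (layerKernel p R) := by
  refine .of_bounds (C := R) (R := max R (R / r)) ?_ ?_ ?_ ?_
  · refine Measurable.indicator (by fun_prop) ?_
    exact (measurableSet_le (hp.comp measurable_snd) measurable_fst).inter
      (measurable_fst measurableSet_Ioc)
  · exact fun q => indicator_nonneg (fun q hq => mul_nonneg hq.2.1.le (Real.exp_pos _).le) q
  · refine fun q => indicator_le' (fun q hq => ?_) (fun _ _ => hR) q
    calc q.1 * Real.exp (-(1 / 2) * q.1 ^ 2) ≤ R * 1 := by
          refine mul_le_mul hq.2.2 (Real.exp_le_one_iff.2 ?_) (Real.exp_pos _).le hR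
          nlinarith [sq_nonneg q.1]
      _ = R := mul_one R
  · refine fun q hq => indicator_of_notMem (fun hq' => hq.not_ge ?_) _
    refine max_le_max ?_ ?_
    · rw [Real.norm_of_nonneg hq'.2.1.le]; exact hq'.2.2
    · rw [le_div_iff₀ hr, mul_comm]; exact (hb _).trans (hq'.1.trans hq'.2.2)

theorem isTame_layer (hp : Measurable p) (hr : 0 < r) (hb : ∀ x, r * ‖x‖ ≤ p x) (hR : 0 ≤ R) :
    IsTame (layer p R) :=
  (isTame_layerKernel hp hr hb hR).integral_slice volume

/-- Without the cutoff at R the layer integral is ∫ t e^{-t²/2} over t ≥ p x, which equals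
e^{-p(x)²/2}. -/
theorem layer_le_exp {x : EuclideanSpace ℝ (Fin d)} (h0 : 0 ≤ p x) :
    layer p R x ≤ Real.exp (-(p x ^ 2 / 2)) := by
  have hint : Integrable fun t : ℝ => t * Real.exp (-(1 / 2) * t ^ 2) :=
    integrable_mul_exp_neg_mul_sq (by norm_num)
  have hval : ∫ t in Ioi (p x), t * Real.exp (-(1 / 2) * t ^ 2) = Real.exp (-(p x ^ 2 / 2)) := by
    have hd : ∀ t : ℝ, HasDerivAt (fun t => -Real.exp (-(1 / 2) * t ^ 2))
        (t * Real.exp (-(1 / 2) * t ^ 2)) t := fun t => by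
      refine (((hasDerivAt_pow 2 t).const_mul (-(1 / 2 : ℝ))).exp).fun_neg.congr_deriv ?_
      push_cast
      ring
    rw [integral_Ioi_of_hasDerivAt_of_tendsto' (m := 0) (fun t _ => hd t) hint.integrableOn]
    · rw [zero_sub, neg_neg]; congr 1; ring_nf
    · rw [← neg_zero]
      refine (Real.tendsto_exp_atBot.comp ?_).neg
      exact (tendsto_pow_atTop two_ne_zero).const_mul_atTop_of_neg (by norm_num)
  rw [← hval, ← integral_Ici_eq_integral_Ioi, ← integral_indicator measurableSet_Ici]
  refine integral_mono_of_nonneg (ae_of_all _ fun t => ?_)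
    (hint.indicator measurableSet_Ici) (ae_of_all _ fun t => ?_)
  · exact indicator_nonneg
      (fun q (hq : _ ∧ _ ∧ _) => mul_nonneg hq.2.1.le (Real.exp_pos _).le) _
  · by_cases ht : p x ≤ t ∧ t ∈ Ioc 0 R
    · rw [indicator_of_mem (show t ∈ Ici (p x) from ht.1)]
      exact (indicator_of_mem (s := {q : ℝ × EuclideanSpace ℝ (Fin d) |
        p q.2 ≤ q.1 ∧ q.1 ∈ Ioc 0 R}) (a := (t, x)) ht _).le
    · have e : layerKernel p R (t, x) = 0 := indicator_of_notMem (s := {q :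
        ℝ × EuclideanSpace ℝ (Fin d) | p q.2 ≤ q.1 ∧ q.1 ∈ Ioc 0 R}) ht _
      simp only [e]
      exact indicator_nonneg (fun t (ht : p x ≤ t) =>
        mul_nonneg (h0.trans ht) (Real.exp_pos _).le) _

theorem sublevel_eq_smul (hhom : ∀ t > 0, ∀ x, p (t • x) = t * p x) {t : ℝ} (ht : 0 < t) :
    {x | p x ≤ t} = t • {x | p x ≤ 1} := by
  ext x
  rw [mem_smul_set_iff_inv_smul_mem₀ ht.ne']
  simp only [mem_ofPred_eq]
  rw [hhom _ (inv_pos.2 ht), inv_mul_le_iff₀ ht, mul_one]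

/-- Fubini, with {p ≤ t} = t • {p ≤ 1} contributing t^{d+k}. Degree k = 0 gives the mass; k = 1
shows that the layer inherits a barycenter at the origin. -/
theorem integral_layer_mul (hp : Measurable p) (hr : 0 < r) (hb : ∀ x, r * ‖x‖ ≤ p x) (hR : 0 ≤ R)
    (hhom : ∀ t > 0, ∀ x, p (t • x) = t * p x) {ℓ : EuclideanSpace ℝ (Fin d) → ℝ}
    (hℓ : Continuous ℓ) {k : ℕ} (hℓh : ∀ (t : ℝ) x, ℓ (t • x) = t ^ k * ℓ x) :
    ∫ x, layer p R x * ℓ x = (∫ t in Ioc 0 R, t ^ (d + k + 1) * Real.exp (-(1 / 2) * t ^ 2)) *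
      ∫ x in {x | p x ≤ 1}, ℓ x := by
  have hK := isTame_layerKernel hp hr hb hR
  have hi : Integrable (fun q : ℝ × EuclideanSpace ℝ (Fin d) => layerKernel p R q * ℓ q.2)
      (volume.prod volume) :=
    hK.integrable_smul (g := fun q => ℓ q.2) (by fun_prop)
  simp only [layer, ← integral_mul_const]
  rw [← integral_prod_symm _ hi, integral_prod _ hi, ← integral_indicator measurableSet_Ioc]
  refine integral_congr_ae (ae_of_all _ fun t => ?_)
  by_cases ht : t ∈ Ioc 0 R
  · have hms : MeasurableSet {x | p x ≤ t} := measurableSet_le hp measurable_const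
    have e : ∀ x, layerKernel p R (t, x) * ℓ x =
        {x | p x ≤ t}.indicator (fun x => t * Real.exp (-(1 / 2) * t ^ 2) * ℓ x) x := fun x => by
      by_cases hx : p x ≤ t
      · rw [indicator_of_mem (show x ∈ {x | p x ≤ t} from hx), layerKernel,
          indicator_of_mem (s := {q : ℝ × EuclideanSpace ℝ (Fin d) | p q.2 ≤ q.1 ∧ q.1 ∈ Ioc 0 R})
            (a := (t, x)) ⟨hx, ht⟩]
      · rw [indicator_of_notMem (show x ∉ {x | p x ≤ t} from hx), layerKernel,
          indicator_of_notMem (fun h => hx h.1), zero_mul]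
    simp only [e]
    rw [integral_indicator hms, integral_const_mul, indicator_of_mem ht, sublevel_eq_smul hhom ht.1]
    have hs := Measure.setIntegral_comp_smul_of_pos volume ℓ {x | p x ≤ 1} ht.1
    simp only [hℓh, integral_const_mul, finrank_euclideanSpace, Fintype.card_fin, smul_eq_mul] at hs
    rw [eq_inv_mul_iff_mul_eq₀ (pow_pos ht.1 d).ne'] at hs
    rw [← hs]
    ring
  · rw [indicator_of_notMem ht]
    refine integral_eq_zero_of_ae (ae_of_all _ fun x => ?_)
    simp only [layerKernel, Pi.zero_apply]
    rw [indicator_of_notMem (fun h => ht h.2), zero_mul]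

/-- The value of (∫ e^{-|x|²/2})² computed by layers: it converts the Gaussian constant (2π)^d into
the squared volume of the ball. -/
theorem sq_integral_pow_mul_exp_mul_volume (d : ℕ) [NeZero d] :
    (∫ t in Ioi (0 : ℝ), t ^ (d + 1) * Real.exp (-(1 / 2) * t ^ 2)) ^ 2 *
      volume.real (Metric.closedBall (0 : EuclideanSpace ℝ (Fin d)) 1) ^ 2 = (2 * Real.pi) ^ d := by
  have h1 := integral_rpow_mul_exp_neg_mul_rpow (p := 2) (q := (d + 1 : ℕ)) (b := 1 / 2)
    (by norm_num) (by push_cast; linarith [(Nat.cast_nonneg d : (0 : ℝ) ≤ d)]) (by norm_num)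
  simp only [Real.rpow_natCast, Real.rpow_ofNat] at h1
  have e1 : (-(((d + 1 : ℕ) : ℝ) + 1) / 2) = -((d : ℝ) / 2 + 1) := by push_cast; ring
  have e2 : ((((d + 1 : ℕ) : ℝ) + 1) / 2) = (d : ℝ) / 2 + 1 := by push_cast; ring
  have hG : 0 < Real.Gamma ((d : ℝ) / 2 + 1) := Real.Gamma_pos_of_pos (by positivity)
  have e3 : ((1 / 2 : ℝ) ^ (-((d : ℝ) / 2 + 1))) ^ 2 = 2 ^ d * 4 := by
    rw [one_div, Real.inv_rpow (by norm_num), Real.rpow_neg (by norm_num), inv_inv,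
      ← Real.rpow_natCast, ← Real.rpow_mul (by norm_num)]
    have : ((d : ℝ) / 2 + 1) * (2 : ℕ) = (d : ℝ) + (2 : ℕ) := by push_cast; ring
    rw [this, Real.rpow_add (by norm_num), Real.rpow_natCast, Real.rpow_natCast]
    norm_num
  have hv : volume.real (Metric.closedBall (0 : EuclideanSpace ℝ (Fin d)) 1) =
      √Real.pi ^ d / Real.Gamma ((d : ℝ) / 2 + 1) := by
    rw [measureReal_def, EuclideanSpace.volume_closedBall]
    simp only [ENNReal.ofReal_one, one_pow, one_mul, Fintype.card_fin]
    exact ENNReal.toReal_ofReal (by positivity)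
  rw [h1, hv, e1, e2, mul_pow, mul_pow, e3, div_pow (√Real.pi ^ d), ← pow_mul, mul_comm d 2, pow_mul,
    Real.sq_sqrt Real.pi_pos.le, mul_pow]
  field_simp
  norm_num

/-- From ⟨x, y⟩ ≤ p(x) q(y) ≤ (p(x)² + q(y)²)/2, the truncations of e^{-p²/2} and e^{-q²/2} satisfy
the functional hypothesis. The cutoff makes them tame and is removed by R → ∞. -/
theorem volume_real_mul_le_of_sublevel [NeZero d] {q : EuclideanSpace ℝ (Fin d) → ℝ} {s : ℝ}
    (hp : Measurable p) (hq : Measurable q)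
    (hr : 0 < r) (hb : ∀ x, r * ‖x‖ ≤ p x) (hs : 0 < s) (hb' : ∀ x, s * ‖x‖ ≤ q x)
    (hhom : ∀ t > 0, ∀ x, p (t • x) = t * p x) (hhom' : ∀ t > 0, ∀ x, q (t • x) = t * q x)
    (h0 : ∀ i, ∫ x in {x | p x ≤ 1}, x i = 0) (h : ∀ x y, inner ℝ x y ≤ p x * q y) :
    volume.real {x | p x ≤ 1} * volume.real {x | q x ≤ 1} ≤
      volume.real (Metric.closedBall (0 : EuclideanSpace ℝ (Fin d)) 1) ^ 2 := by
  set c : ℝ → ℝ := fun R => ∫ t in Ioc 0 R, t ^ (d + 1) * Real.exp (-(1 / 2) * t ^ 2) with hc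
  set c' : ℝ := ∫ t in Ioi 0, t ^ (d + 1) * Real.exp (-(1 / 2) * t ^ 2) with hc'
  have hp0 : ∀ x, 0 ≤ p x := fun x => (mul_nonneg hr.le (norm_nonneg x)).trans (hb x)
  have hq0 : ∀ x, 0 ≤ q x := fun x => (mul_nonneg hs.le (norm_nonneg x)).trans (hb' x)
  have mass : ∀ {p : EuclideanSpace ℝ (Fin d) → ℝ} {r : ℝ}, Measurable p → 0 < r →
      (∀ x, r * ‖x‖ ≤ p x) → (∀ t > 0, ∀ x, p (t • x) = t * p x) → ∀ R, 0 ≤ R →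
      ∫ x, layer p R x = c R * volume.real {x | p x ≤ 1} := by
    intro p r hp hr hb hhom R hR
    have := integral_layer_mul hp hr hb hR hhom (ℓ := fun _ => 1) (k := 0) continuous_const
      (by simp)
    simpa [hc] using this
  have fin : ∀ R, 0 ≤ R → volume.real {x | p x ≤ 1} * volume.real {x | q x ≤ 1} * c R ^ 2 ≤
      (2 * Real.pi) ^ d := by
    intro R hR
    have := integral_mul_integral_le_of_barycenter_eq_zero (isTame_layer hp hr hb hR)
      (isTame_layer hq hs hb' hR) (fun i => ?_) (fun x y => ?_)
    · rw [mass hp hr hb hhom R hR, mass hq hs hb' hhom' R hR] at this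
      linarith
    · rw [integral_layer_mul hp hr hb hR hhom (ℓ := fun x => x i) (k := 1) (by fun_prop) (by simp),
        h0, mul_zero]
    · calc layer p R x * layer q R y ≤ Real.exp (-(p x ^ 2 / 2)) * Real.exp (-(q y ^ 2 / 2)) :=
          mul_le_mul (layer_le_exp (hp0 x)) (layer_le_exp (hq0 y))
            ((isTame_layer hq hs hb' hR).nonneg y) (Real.exp_pos _).le
        _ ≤ _ := by
          rw [← Real.exp_add]
          refine Real.exp_le_exp.2 ?_
          nlinarith [h x y, sq_nonneg (p x - q y)]
  have hci : IntegrableOn (fun t : ℝ => t ^ (d + 1) * Real.exp (-(1 / 2) * t ^ 2)) (Ioi 0) := by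
    have := integrable_rpow_mul_exp_neg_mul_sq (b := 1 / 2) (s := (d + 1 : ℕ)) (by norm_num)
      (by push_cast; linarith [(Nat.cast_nonneg d : (0 : ℝ) ≤ d)])
    simpa only [Real.rpow_natCast] using this.integrableOn
  have hlim : Tendsto c atTop (𝓝 c') := by
    refine (intervalIntegral_tendsto_integral_Ioi 0 hci tendsto_id).congr' ?_
    filter_upwards [eventually_ge_atTop 0] with R hR
    exact intervalIntegral.integral_of_le hR
  have hfin : volume.real {x | p x ≤ 1} * volume.real {x | q x ≤ 1} * c' ^ 2 ≤
      (2 * Real.pi) ^ d :=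
    le_of_tendsto ((hlim.pow 2).const_mul _) ((eventually_ge_atTop 0).mono fin)
  have hcv := sq_integral_pow_mul_exp_mul_volume d
  rw [← hcv, mul_comm] at hfin
  have hcp : 0 < c' ^ 2 := by
    refine (sq_nonneg _).lt_of_ne' fun h0 => ?_
    rw [← hc', h0, zero_mul] at hcv
    have := pow_pos Real.two_pi_pos d
    linarith
  exact le_of_mul_le_mul_left hfin hcp

end Layer

/-! ### Support functions and Blaschke–Santaló at the barycenter -/

section SupportFn

variable {n : ℕ} (Ω : ConvexBody (EuclideanSpace ℝ (Fin (n + 1))))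
  (z₀ : EuclideanSpace ℝ (Fin (n + 1)))

theorem continuous_supportFn : Continuous (supportFn Ω z₀) :=
  Ω.isCompact.continuous_sSup (f := fun x z => inner ℝ x (z - z₀)) (by fun_prop)

variable {Ω}

theorem inner_le_supportFn {z : EuclideanSpace ℝ (Fin (n + 1))} (hz : z ∈ Ω)
    (x : EuclideanSpace ℝ (Fin (n + 1))) : inner ℝ x (z - z₀) ≤ supportFn Ω z₀ x :=
  le_csSup (Ω.isCompact.image (by fun_prop)).bddAbove ⟨z, hz, rfl⟩

variable (Ω)

theorem exists_inner_eq_supportFn (x : EuclideanSpace ℝ (Fin (n + 1))) :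
    ∃ z ∈ Ω, inner ℝ x (z - z₀) = supportFn Ω z₀ x :=
  (Ω.isCompact.image (f := fun z => inner ℝ x (z - z₀)) (by fun_prop)).sSup_mem
    (Ω.nonempty.image _)

theorem supportFn_le_iff {x : EuclideanSpace ℝ (Fin (n + 1))} {t : ℝ} :
    supportFn Ω z₀ x ≤ t ↔ ∀ z ∈ Ω, inner ℝ x (z - z₀) ≤ t := by
  refine ⟨fun h z hz => (inner_le_supportFn z₀ hz x).trans h, fun h => ?_⟩
  obtain ⟨z, hz, e⟩ := exists_inner_eq_supportFn Ω z₀ x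
  exact e ▸ h z hz

theorem supportFn_smul {t : ℝ} (ht : 0 < t) (x : EuclideanSpace ℝ (Fin (n + 1))) :
    supportFn Ω z₀ (t • x) = t * supportFn Ω z₀ x := by
  refine le_antisymm ((supportFn_le_iff Ω z₀).2 fun z hz => ?_) ?_
  · rw [real_inner_smul_left]
    exact mul_le_mul_of_nonneg_left (inner_le_supportFn z₀ hz x) ht.le
  · obtain ⟨z, hz, e⟩ := exists_inner_eq_supportFn Ω z₀ x
    rw [← e, ← real_inner_smul_left]
    exact inner_le_supportFn z₀ hz _

theorem supportFn_eq_sub (z₁ x : EuclideanSpace ℝ (Fin (n + 1))) :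
    supportFn Ω z₁ x = supportFn Ω z₀ x - inner ℝ x (z₁ - z₀) := by
  refine le_antisymm ((supportFn_le_iff Ω z₁).2 fun z hz => ?_) ?_
  · have := inner_le_supportFn z₀ hz x
    have e : inner ℝ x (z - z₁) = inner ℝ x (z - z₀) - inner ℝ x (z₁ - z₀) := by
      rw [← inner_sub_right]; congr 1; abel
    linarith
  · obtain ⟨z, hz, e⟩ := exists_inner_eq_supportFn Ω z₀ x
    rw [← e, ← inner_sub_right]
    have e' : z - z₀ - (z₁ - z₀) = z - z₁ := by abel
    rw [e']
    exact inner_le_supportFn z₁ hz x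

theorem supportFn_add_le (x y : EuclideanSpace ℝ (Fin (n + 1))) :
    supportFn Ω z₀ (x + y) ≤ supportFn Ω z₀ x + supportFn Ω z₀ y := by
  refine (supportFn_le_iff Ω z₀).2 fun z hz => ?_
  rw [inner_add_left]
  exact add_le_add (inner_le_supportFn z₀ hz x) (inner_le_supportFn z₀ hz y)

variable {z₀}

theorem supportFn_nonneg (hz₀ : z₀ ∈ Ω) (x : EuclideanSpace ℝ (Fin (n + 1))) :
    0 ≤ supportFn Ω z₀ x := by
  simpa using inner_le_supportFn z₀ hz₀ x

theorem exists_mul_norm_le_supportFn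
    (hz₀ : z₀ ∈ interior (Ω : Set (EuclideanSpace ℝ (Fin (n + 1))))) :
    ∃ r > 0, ∀ x, r * ‖x‖ ≤ supportFn Ω z₀ x := by
  obtain ⟨r, hr, hb⟩ := Metric.nhds_basis_closedBall.mem_iff.1 (mem_interior_iff_mem_nhds.1 hz₀)
  refine ⟨r, hr, fun x => ?_⟩
  rcases eq_or_ne x 0 with rfl | hx
  · simpa using supportFn_nonneg Ω (interior_subset hz₀) 0
  have hx' := norm_pos_iff.2 hx
  have hmem : z₀ + (r / ‖x‖) • x ∈ Ω := hb (by
    simp [norm_smul, abs_of_pos hr, hx'.ne'])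
  have := inner_le_supportFn z₀ hmem x
  rw [add_sub_cancel_left, real_inner_smul_right, real_inner_self_eq_norm_sq] at this
  convert this using 1
  field_simp

variable (z₀)

theorem volume_polarDual : volume (polarDual Ω z₀) = volume {x | supportFn Ω z₀ x ≤ 1} := by
  have : polarDual Ω z₀ = (fun w => w - z₀) ⁻¹' {x | supportFn Ω z₀ x ≤ 1} := by
    ext w
    exact (supportFn_le_iff Ω z₀).symm
  rw [this]
  simpa only [sub_eq_add_neg] using measure_preimage_add_right volume (-z₀) _

theorem volume_polarDual_ne_top
    (hz₀ : z₀ ∈ interior (Ω : Set (EuclideanSpace ℝ (Fin (n + 1))))) :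
    volume (polarDual Ω z₀) ≠ ∞ := by
  obtain ⟨r, hr, hb⟩ := exists_mul_norm_le_supportFn Ω hz₀
  rw [volume_polarDual]
  refine ((measure_mono fun x (hx : supportFn Ω z₀ x ≤ 1) => ?_).trans_lt
    (measure_closedBall_lt_top (x := 0) (r := 1 / r))).ne
  rw [mem_closedBall_zero_iff, le_div_iff₀ hr, mul_comm]
  exact (hb x).trans hx

/-- The Blaschke–Santaló inequality for the polar dual with respect to the barycenter. -/
theorem volume_mul_volume_polarDual_le
    (hz₀ : z₀ ∈ interior (Ω : Set (EuclideanSpace ℝ (Fin (n + 1)))))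
    (hbar : ∀ i, ∫ x in (Ω : Set (EuclideanSpace ℝ (Fin (n + 1)))), (x - z₀) i = 0) :
    volume.real (Ω : Set (EuclideanSpace ℝ (Fin (n + 1)))) * volume.real (polarDual Ω z₀) ≤
      volume.real (Metric.closedBall (0 : EuclideanSpace ℝ (Fin (n + 1))) 1) ^ 2 := by
  set K : Set (EuclideanSpace ℝ (Fin (n + 1))) := (fun x => x + z₀) ⁻¹' Ω with hK
  have hKconv : Convex ℝ K := Ω.convex.translate_preimage_left z₀
  have hKcomp : IsCompact K := (Homeomorph.addRight z₀).isCompact_preimage.2 Ω.isCompact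
  have hK0 : K ∈ 𝓝 0 := by
    have : Tendsto (fun x => x + z₀) (𝓝 0) (𝓝 z₀) := by
      have : Continuous fun x : EuclideanSpace ℝ (Fin (n + 1)) => x + z₀ := by fun_prop
      simpa using this.tendsto 0
    exact this (mem_interior_iff_mem_nhds.1 hz₀)
  have hgK : {x | gauge K x ≤ 1} = K := by
    ext x
    rw [mem_ofPred_eq, gauge_le_one_iff_mem_closure hKconv hK0, hKcomp.isClosed.closure_eq]
  obtain ⟨ρ, hρ, hKρ⟩ := hKcomp.isBounded.subset_closedBall_lt 0 0
  have hglow : ∀ x, ρ⁻¹ * ‖x‖ ≤ gauge K x := fun x => by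
    rw [inv_mul_eq_div]
    exact le_gauge_of_subset_closedBall (absorbent_nhds_zero hK0) hρ.le hKρ
  obtain ⟨r, hr, hb⟩ := exists_mul_norm_le_supportFn Ω hz₀
  have hvK : volume K = volume (Ω : Set (EuclideanSpace ℝ (Fin (n + 1)))) :=
    measure_preimage_add_right volume z₀ _
  -- The gauge of Ω - z₀ and the support function are dual: their unit sublevel sets are the
  -- translated body and its translated polar, and ⟨x, y⟩ is at most the product of their values.
  have key := volume_real_mul_le_of_sublevel (p := gauge K) (q := supportFn Ω z₀)
    (continuous_gauge hKconv hK0).measurable (continuous_supportFn Ω z₀).measurable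
    (inv_pos.2 hρ) hglow hr hb
    (fun t ht x => by rw [gauge_smul_of_nonneg ht.le, smul_eq_mul])
    (fun t ht x => supportFn_smul Ω z₀ ht x) (fun i => ?_) (fun x y => ?_)
  · simp only [measureReal_def] at key ⊢
    rwa [volume_polarDual, ← hvK, ← hgK]
  · rw [hgK, ← hbar i]
    have := (measurePreserving_add_right volume z₀).setIntegral_preimage_emb
      (MeasurableEquiv.addRight z₀).measurableEmbedding (fun x => (x - z₀) i) Ω
    simpa using this
  · rcases (gauge_nonneg (s := K) x).eq_or_lt with h0 | h0
    · have hx : x = 0 := by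
        have := hglow x
        rw [← h0] at this
        by_contra hx
        have := mul_pos (inv_pos.2 hρ) (norm_pos_iff.2 hx)
        linarith
      simp [hx]
    · have hmem : (gauge K x)⁻¹ • x ∈ K := by
        refine hgK.subset ?_
        rw [mem_ofPred_eq, gauge_smul_of_nonneg (inv_nonneg.2 h0.le), smul_eq_mul,
          inv_mul_cancel₀ h0.ne']
      have := inner_le_supportFn z₀ (show (gauge K x)⁻¹ • x + z₀ ∈ Ω from hmem) y
      rw [add_sub_cancel_right, real_inner_smul_right, inv_mul_le_iff₀ h0, real_inner_comm] at this
      exact this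

variable {Ω}

theorem exists_mem_interior_volume_mul_volume_polarDual_le
    (hΩ : (interior (Ω : Set (EuclideanSpace ℝ (Fin (n + 1))))).Nonempty) :
    ∃ z₀ ∈ interior (Ω : Set (EuclideanSpace ℝ (Fin (n + 1)))),
      volume.real (Ω : Set (EuclideanSpace ℝ (Fin (n + 1)))) * volume.real (polarDual Ω z₀) ≤
        volume.real (Metric.closedBall (0 : EuclideanSpace ℝ (Fin (n + 1))) 1) ^ 2 := by
  have hpos : 0 < volume (Ω : Set (EuclideanSpace ℝ (Fin (n + 1)))) :=
    (isOpen_interior.measure_pos volume hΩ).trans_le (measure_mono interior_subset)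
  have hfin := Ω.isCompact.measure_lt_top (μ := volume)
  set z₀ := ⨍ x in (Ω : Set (EuclideanSpace ℝ (Fin (n + 1)))), x with hz₀
  have hid : IntegrableOn (fun x : EuclideanSpace ℝ (Fin (n + 1)) => x) Ω :=
    continuous_id.continuousOn.integrableOn_compact Ω.isCompact
  have hint : z₀ ∈ interior (Ω : Set (EuclideanSpace ℝ (Fin (n + 1)))) := by
    obtain ⟨a, ha⟩ := hΩ
    obtain ⟨r, hr, hb⟩ := Metric.nhds_basis_closedBall.mem_iff.1 (isOpen_interior.mem_nhds ha)
    have hmt : MeasurableSet (Metric.closedBall a r) := measurableSet_closedBall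
    have hvt : (volume.restrict (Ω : Set (EuclideanSpace ℝ (Fin (n + 1)))))
        (Metric.closedBall a r) = volume (Metric.closedBall a r) := by
      rw [Measure.restrict_apply hmt, inter_eq_left.2 (hb.trans interior_subset)]
    have : IsFiniteMeasure (volume.restrict (Ω : Set (EuclideanSpace ℝ (Fin (n + 1))))) :=
      ⟨by simpa using hfin⟩
    have h0 : (volume.restrict (Ω : Set (EuclideanSpace ℝ (Fin (n + 1)))))
        (Metric.closedBall a r) ≠ 0 := by
      rw [hvt]; exact (Metric.measure_closedBall_pos volume a hr).ne'
    -- The average over a small ball inside the interior stays in that ball; since the ball has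
    -- positive measure, this forces the average over Ω into the interior.
    refine Ω.convex.average_mem_interior_of_set h0
      (ae_restrict_mem Ω.isCompact.measurableSet) hid (hb ?_)
    exact (convex_closedBall a r).set_average_mem Metric.isClosed_closedBall h0
      (measure_ne_top _ _) (ae_restrict_mem hmt) hid.integrableOn
  refine ⟨z₀, hint, volume_mul_volume_polarDual_le Ω z₀ hint fun i => ?_⟩
  have : IsFiniteMeasure (volume.restrict (Ω : Set (EuclideanSpace ℝ (Fin (n + 1))))) :=
    ⟨by simpa using hfin⟩
  have h1 : ∫ x in (Ω : Set (EuclideanSpace ℝ (Fin (n + 1)))), (x - z₀) = 0 :=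
    integral_sub_average _ _
  have h2 := (EuclideanSpace.proj (𝕜 := ℝ) i).integral_comp_comm (hid.sub (integrable_const z₀))
  simpa [h1] using h2

end SupportFn

/-! ### Existence and uniqueness of the Santaló point -/

section Santalo

variable {n : ℕ} (Ω : ConvexBody (EuclideanSpace ℝ (Fin (n + 1))))

/-- The integral of `e^{-u_z}`, a multiple of the volume of the polar dual with respect to `z`. -/
noncomputable def expIntegral (z : EuclideanSpace ℝ (Fin (n + 1))) : ℝ≥0∞ :=
  ∫⁻ x, ENNReal.ofReal (Real.exp (-supportFn Ω z x))

theorem lintegral_ofReal_exp_neg_mul_pow (k : ℕ) :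
    ∫⁻ t in Ioi (0 : ℝ), ENNReal.ofReal (Real.exp (-t) * t ^ k) =
      ENNReal.ofReal (Real.Gamma (k + 1)) := by
  have h := Real.GammaIntegral_convergent (s := k + 1) (by positivity)
  simp only [add_sub_cancel_right, Real.rpow_natCast] at h
  rw [Real.Gamma_eq_integral (by positivity)]
  simp only [add_sub_cancel_right, Real.rpow_natCast]
  rw [ofReal_integral_eq_lintegral_ofReal h]
  filter_upwards [ae_restrict_mem measurableSet_Ioi] with t ht
  exact mul_nonneg (Real.exp_pos _).le (pow_nonneg (le_of_lt ht) _)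

variable {Ω}

/-- Write e^{-u} as ∫ e^{-t} over t ≥ u and swap integrals: the sublevel sets scale as t^{n+1},
leaving a Gamma integral. Minimizing the polar volume thus means minimizing an integral of functions
convex in z. -/
theorem expIntegral_eq {z : EuclideanSpace ℝ (Fin (n + 1))} (hz : z ∈ Ω) :
    expIntegral Ω z =
      ENNReal.ofReal (Real.Gamma ((n + 1 : ℕ) + 1)) * volume (polarDual Ω z) := by
  have hu := continuous_supportFn Ω z
  set S : Set (EuclideanSpace ℝ (Fin (n + 1)) × ℝ) := {q | supportFn Ω z q.1 ≤ q.2} with hS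
  have hSm : MeasurableSet S :=
    measurableSet_le (hu.measurable.comp measurable_fst) measurable_snd
  set F : EuclideanSpace ℝ (Fin (n + 1)) → ℝ → ℝ≥0∞ := fun x t =>
    S.indicator (fun q => ENNReal.ofReal (Real.exp (-q.2))) (x, t) with hF
  have h1 : ∀ x, ENNReal.ofReal (Real.exp (-supportFn Ω z x)) = ∫⁻ t in Ioi 0, F x t := by
    intro x
    have hu0 := supportFn_nonneg Ω hz x
    have e : ∀ t, F x t =
        (Ici (supportFn Ω z x)).indicator (fun t => ENNReal.ofReal (Real.exp (-t))) t := by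
      intro t
      by_cases ht : supportFn Ω z x ≤ t
      · rw [hF, indicator_of_mem (show t ∈ Ici _ from ht)]
        exact indicator_of_mem (show (x, t) ∈ S from ht) _
      · rw [hF, indicator_of_notMem (show t ∉ Ici _ from ht)]
        exact indicator_of_notMem (show (x, t) ∉ S from ht) _
    simp only [e]
    rw [lintegral_indicator measurableSet_Ici, Measure.restrict_restrict measurableSet_Ici,
      ← integral_exp_neg_Ioi, ofReal_integral_eq_lintegral_ofReal (integrableOn_exp_neg_Ioi _)
        (ae_of_all _ fun t => (Real.exp_pos _).le)]
    have : (Ici (supportFn Ω z x) ∩ Ioi 0 : Set ℝ) =ᵐ[volume] Ioi (supportFn Ω z x) := by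
      have h2 : (Ici (supportFn Ω z x) : Set ℝ) =ᵐ[volume] Ioi (supportFn Ω z x) :=
        Ioi_ae_eq_Ici.symm
      have h3 : (Ioi (supportFn Ω z x) ∩ Ioi 0 : Set ℝ) = Ioi (supportFn Ω z x) :=
        inter_eq_left.2 (Ioi_subset_Ioi hu0)
      exact (h2.inter (ae_eq_refl _)).trans (EventuallyEq.of_eq h3)
    rw [setLIntegral_congr this]
  rw [expIntegral]
  simp only [h1]
  rw [lintegral_lintegral_swap]
  · rw [← lintegral_ofReal_exp_neg_mul_pow, ← lintegral_mul_const _ (by fun_prop)]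
    refine setLIntegral_congr_fun measurableSet_Ioi fun t (ht : 0 < t) => ?_
    have e : ∀ x, F x t =
        {x | supportFn Ω z x ≤ t}.indicator (fun _ => ENNReal.ofReal (Real.exp (-t))) x := by
      intro x
      by_cases hx : supportFn Ω z x ≤ t
      · rw [hF, indicator_of_mem (show x ∈ {x | supportFn Ω z x ≤ t} from hx)]
        exact indicator_of_mem (show (x, t) ∈ S from hx) _
      · rw [hF, indicator_of_notMem (show x ∉ {x | supportFn Ω z x ≤ t} from hx)]
        exact indicator_of_notMem (show (x, t) ∉ S from hx) _
    simp only [e]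
    rw [lintegral_indicator_const (measurableSet_le hu.measurable measurable_const),
      sublevel_eq_smul (fun t ht x => supportFn_smul Ω z ht x) ht, Measure.addHaar_smul,
      volume_polarDual, ENNReal.ofReal_mul (Real.exp_pos _).le, mul_assoc, finrank_euclideanSpace,
      Fintype.card_fin, abs_of_pos (pow_pos ht _)]
  · refine Measurable.aemeasurable ?_
    exact (Measurable.indicator (by fun_prop) hSm)

theorem volume_polarDual_le_iff {z w : EuclideanSpace ℝ (Fin (n + 1))} (hz : z ∈ Ω) (hw : w ∈ Ω) :
    volume (polarDual Ω z) ≤ volume (polarDual Ω w) ↔ expIntegral Ω z ≤ expIntegral Ω w := by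
  rw [expIntegral_eq hz, expIntegral_eq hw,
    ENNReal.mul_le_mul_iff_right (by
      simpa using Real.Gamma_pos_of_pos (s := ((n + 1 : ℕ) : ℝ) + 1) (by positivity))
      ENNReal.ofReal_ne_top]

theorem isSantaloPoint_iff {z : EuclideanSpace ℝ (Fin (n + 1))} :
    IsSantaloPoint Ω z ↔ z ∈ Ω ∧ ∀ w ∈ Ω, expIntegral Ω z ≤ expIntegral Ω w :=
  and_congr_right fun hz => forall₂_congr fun _ hw => volume_polarDual_le_iff hz hw

variable (Ω)

theorem continuous_supportFn_left (x : EuclideanSpace ℝ (Fin (n + 1))) :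
    Continuous fun z => supportFn Ω z x := by
  rw [funext fun z => supportFn_eq_sub Ω 0 z x]
  fun_prop

/-- Fatou's lemma, as u_z(x) is continuous in z; infinite values are allowed. -/
theorem lowerSemicontinuous_expIntegral : LowerSemicontinuous (expIntegral Ω) := by
  intro z
  refine lowerSemicontinuousAt_iff_le_liminf.2 ?_
  have h1 : expIntegral Ω z =
      ∫⁻ x, liminf (fun w => ENNReal.ofReal (Real.exp (-supportFn Ω w x))) (𝓝 z) := by
    refine lintegral_congr fun x => (Tendsto.liminf_eq ?_).symm
    have := continuous_supportFn_left Ω x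
    exact (ENNReal.continuous_ofReal.comp (Real.continuous_exp.comp this.neg)).tendsto z
  rw [h1]
  refine lintegral_liminf_le fun w => ?_
  have := (continuous_supportFn Ω w).measurable
  fun_prop

theorem exists_isSantaloPoint : ∃ z, IsSantaloPoint Ω z := by
  obtain ⟨z, hz, h⟩ := (lowerSemicontinuous_expIntegral Ω).lowerSemicontinuousOn
    (Ω : Set (EuclideanSpace ℝ (Fin (n + 1)))) |>.exists_isMinOn Ω.nonempty Ω.isCompact
  exact ⟨z, isSantaloPoint_iff.2 ⟨hz, fun w hw => h hw⟩⟩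

variable {Ω}

/-- At the midpoint m, u_m is the mean of u_{z₁} and u_{z₂}, so e^{-u_{z₁}} + e^{-u_{z₂}} - 2
e^{-u_m} is a perfect square. Minimality makes its integral nonpositive, hence it vanishes
everywhere by continuity. -/
theorem IsSantaloPoint.eq {z₁ z₂ : EuclideanSpace ℝ (Fin (n + 1))} (h₁ : IsSantaloPoint Ω z₁)
    (h₂ : IsSantaloPoint Ω z₂) (hfin : volume (polarDual Ω z₁) ≠ ∞) : z₁ = z₂ := by
  have hfin₂ : volume (polarDual Ω z₂) ≠ ∞ := ne_top_of_le_ne_top hfin (h₂.2 _ h₁.1)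
  set m := (2⁻¹ : ℝ) • z₁ + (2⁻¹ : ℝ) • z₂ with hm
  have hmΩ : m ∈ Ω := Ω.convex h₁.1 h₂.1 (by norm_num) (by norm_num) (by norm_num)
  set e : EuclideanSpace ℝ (Fin (n + 1)) → EuclideanSpace ℝ (Fin (n + 1)) → ℝ := fun z x =>
    Real.exp (-supportFn Ω z x) with he
  have hec : ∀ z, Continuous (e z) := fun z => by
    have := continuous_supportFn Ω z
    fun_prop
  have hei : ∀ {z}, z ∈ Ω → volume (polarDual Ω z) ≠ ∞ → Integrable (e z) := fun {z} hz hv => by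
    refine ⟨(hec z).aestronglyMeasurable, ?_⟩
    rw [hasFiniteIntegral_iff_ofReal (ae_of_all _ fun x => (Real.exp_pos _).le)]
    have := expIntegral_eq hz
    rw [expIntegral] at this
    rw [this]
    exact ENNReal.mul_lt_top ENNReal.ofReal_lt_top hv.lt_top
  have hi₁ := hei h₁.1 hfin
  have hi₂ := hei h₂.1 hfin₂
  have hsq : ∀ x, e z₁ x + e z₂ x - 2 * e m x =
      (Real.exp (-supportFn Ω z₁ x / 2) - Real.exp (-supportFn Ω z₂ x / 2)) ^ 2 := fun x => by
    have hm' : supportFn Ω m x = (supportFn Ω z₁ x + supportFn Ω z₂ x) / 2 := by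
      rw [supportFn_eq_sub Ω 0 m, supportFn_eq_sub Ω 0 z₁, supportFn_eq_sub Ω 0 z₂]
      simp only [hm, sub_zero, inner_add_right, real_inner_smul_right]
      ring
    simp only [he, hm', sub_sq, ← Real.exp_nat_mul, mul_assoc, ← Real.exp_add]
    ring_nf
  have hmi : Integrable (e m) := by
    refine (hi₁.add hi₂).mono' (hec m).aestronglyMeasurable (ae_of_all _ fun x => ?_)
    have := hsq x
    have h0 : 0 ≤ e m x := (Real.exp_pos _).le
    rw [Real.norm_of_nonneg h0]
    simp only [Pi.add_apply]
    nlinarith [sq_nonneg (Real.exp (-supportFn Ω z₁ x / 2) - Real.exp (-supportFn Ω z₂ x / 2))]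
  have hle : ∀ {z}, IsSantaloPoint Ω z → Integrable (e z) → ∫ x, e z x ≤ ∫ x, e m x :=
    fun {z} hz hi => by
      rw [integral_eq_lintegral_of_nonneg_ae (ae_of_all _ fun x => (Real.exp_pos _).le) hi.1,
        integral_eq_lintegral_of_nonneg_ae (ae_of_all _ fun x => (Real.exp_pos _).le) hmi.1]
      exact ENNReal.toReal_mono hmi.lintegral_lt_top.ne ((isSantaloPoint_iff.1 hz).2 m hmΩ)
  have hgap : ∫ x, (e z₁ x + e z₂ x - 2 * e m x) = 0 := by
    refine le_antisymm ?_ (integral_nonneg fun x => by simp only [hsq]; positivity)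
    have hadd : Integrable fun x => e z₁ x + e z₂ x := hi₁.add hi₂
    rw [integral_sub hadd (hmi.const_mul 2), integral_add hi₁ hi₂, integral_const_mul]
    linarith [hle h₁ hi₁, hle h₂ hi₂]
  have hcont : Continuous fun x => e z₁ x + e z₂ x - 2 * e m x := by
    have := hec z₁; have := hec z₂; have := hec m
    fun_prop
  have hgi : Integrable fun x => e z₁ x + e z₂ x - 2 * e m x :=
    (hi₁.add hi₂).sub (hmi.const_mul 2)
  rw [integral_eq_zero_iff_of_nonneg (fun x => by simp only [hsq]; positivity) hgi,
    Continuous.ae_eq_iff_eq _ hcont continuous_zero] at hgap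
  -- The two support functions differ by ⟨x, z₁ - z₂⟩, which at x = z₁ - z₂ is the squared distance.
  have h0 := congrFun hgap (z₁ - z₂)
  simp only [hsq, Pi.zero_apply, sq_eq_zero_iff, sub_eq_zero, Real.exp_eq_exp] at h0
  rw [supportFn_eq_sub Ω z₂ z₁] at h0
  have : inner ℝ (z₁ - z₂) (z₁ - z₂) = 0 := by linarith
  exact sub_eq_zero.1 (inner_self_eq_zero.1 this)

/-- By subadditivity, moving along the ray of x does not increase u, so a small ball around 0 in {u
< 1} can be translated along the ray infinitely often, giving disjoint balls of equal volume. Hence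
finite polar volume makes u positive on the sphere. -/
theorem volume_polarDual_eq_top {z₀ x : EuclideanSpace ℝ (Fin (n + 1))} (hz₀ : z₀ ∈ Ω)
    (hx : x ≠ 0) (h : supportFn Ω z₀ x ≤ 0) : volume (polarDual Ω z₀) = ∞ := by
  have h0 : supportFn Ω z₀ 0 = 0 :=
    le_antisymm ((supportFn_le_iff Ω z₀).2 fun z _ => by simp) (supportFn_nonneg Ω hz₀ 0)
  have hnhds : {y | supportFn Ω z₀ y < 1} ∈ 𝓝 0 :=
    (isOpen_Iio.preimage (continuous_supportFn Ω z₀)).mem_nhds (by simp [h0])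
  obtain ⟨r, hr, hb⟩ := Metric.mem_nhds_iff.1 hnhds
  have hx' := norm_pos_iff.2 hx
  set v := (2 * r / ‖x‖) • x with hv
  have hvn : ‖v‖ = 2 * r := by
    rw [hv, norm_smul, Real.norm_of_nonneg (by positivity)]; field_simp
  have hv0 : supportFn Ω z₀ v ≤ 0 := by
    rw [hv, supportFn_smul Ω z₀ (by positivity)]
    exact mul_nonpos_of_nonneg_of_nonpos (by positivity) h
  have hkv : ∀ k : ℕ, supportFn Ω z₀ ((k : ℝ) • v) ≤ 0 := fun k => by
    rcases Nat.eq_zero_or_pos k with rfl | hk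
    · simp [h0]
    · rw [supportFn_smul Ω z₀ (by exact_mod_cast hk)]
      exact mul_nonpos_of_nonneg_of_nonpos (by positivity) hv0
  have hsub : ⋃ k : ℕ, Metric.ball ((k : ℝ) • v) r ⊆ {y | supportFn Ω z₀ y ≤ 1} := by
    refine iUnion_subset fun k y hy => ?_
    have h1 : supportFn Ω z₀ (y - (k : ℝ) • v) < 1 := hb (by
      rwa [mem_ball_zero_iff, ← dist_eq_norm])
    have h2 := supportFn_add_le Ω z₀ (y - (k : ℝ) • v) ((k : ℝ) • v)
    rw [sub_add_cancel] at h2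
    exact h2.trans (by linarith [hkv k])
  rw [volume_polarDual, ← top_le_iff]
  refine le_trans (le_of_eq ?_) (measure_mono hsub)
  rw [measure_iUnion]
  · simp only [Measure.addHaar_ball_center]
    exact (ENNReal.tsum_const_eq_top_of_ne_zero (Metric.measure_ball_pos volume 0 hr).ne').symm
  · intro k l hkl
    refine Metric.ball_disjoint_ball ?_
    rw [dist_eq_norm, ← sub_smul, norm_smul, hvn]
    have : (1 : ℝ) ≤ ‖(k : ℝ) - l‖ := by
      rw [Real.norm_eq_abs]
      have h1 : (1 : ℤ) ≤ |(k : ℤ) - l| := Int.one_le_abs (sub_ne_zero.2 (by exact_mod_cast hkl))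
      exact_mod_cast h1
    nlinarith
  · exact fun k => measurableSet_ball

end Santalo

/-! ### Mean of log u on the sphere, and its equality case -/

section Entropy

variable {n : ℕ} {Ω : ConvexBody (EuclideanSpace ℝ (Fin (n + 1)))}
  {z₀ : EuclideanSpace ℝ (Fin (n + 1))}

theorem measurePreserving_neg_sphereMeasure :
    MeasurePreserving (Neg.neg : Metric.sphere (0 : EuclideanSpace ℝ (Fin (n + 1))) 1 → _)
      (sphereMeasure n) (sphereMeasure n) := by
  refine ⟨continuous_neg.measurable, ?_⟩
  ext s hs
  have hs' := continuous_neg.measurable hs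
  rw [Measure.map_apply continuous_neg.measurable hs, sphereMeasure,
    Measure.toSphere_apply' _ hs', Measure.toSphere_apply' _ hs]
  congr 1
  rw [← Measure.measure_neg volume
    (Ioo (0 : ℝ) 1 • ((↑) '' s : Set (EuclideanSpace ℝ (Fin (n + 1)))))]
  congr 1
  ext y
  simp only [Set.mem_neg, Set.mem_smul, Set.mem_image, Set.mem_preimage]
  constructor
  · rintro ⟨t, ht, _, ⟨x, hx, rfl⟩, rfl⟩
    exact ⟨t, ht, _, ⟨-x, hx, rfl⟩, by simp⟩
  · rintro ⟨t, ht, _, ⟨x, hx, rfl⟩, e⟩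
    refine ⟨t, ht, _, ⟨-x, by simpa using hx, rfl⟩, ?_⟩
    rw [← neg_neg y, ← e]
    simp

theorem integral_inner_sphereMeasure (a : EuclideanSpace ℝ (Fin (n + 1))) :
    ∫ x : Metric.sphere (0 : EuclideanSpace ℝ (Fin (n + 1))) 1,
      inner ℝ (x : EuclideanSpace ℝ (Fin (n + 1))) a ∂(sphereMeasure n) = 0 := by
  have h := measurePreserving_neg_sphereMeasure.integral_comp
    (Homeomorph.neg (Metric.sphere (0 : EuclideanSpace ℝ (Fin (n + 1))) 1)).measurableEmbedding
    (fun x => inner ℝ (x : EuclideanSpace ℝ (Fin (n + 1))) a)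
  have e : ∀ x : Metric.sphere (0 : EuclideanSpace ℝ (Fin (n + 1))) 1,
      inner ℝ ((-x : Metric.sphere (0 : EuclideanSpace ℝ (Fin (n + 1))) 1) :
        EuclideanSpace ℝ (Fin (n + 1))) a = -inner ℝ (x : EuclideanSpace ℝ (Fin (n + 1))) a :=
    fun x => by rw [coe_neg_sphere, inner_neg_left]
  rw [integral_congr_ae (ae_of_all _ e), integral_neg] at h
  linarith

instance : IsFiniteMeasure (sphereMeasure n) := by
  unfold sphereMeasure; infer_instance

instance : (sphereMeasure n).IsOpenPosMeasure := by
  unfold sphereMeasure; infer_instance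

theorem sphereMeasure_real_univ :
    (sphereMeasure n).real univ =
      (n + 1) * volume.real (Metric.closedBall (0 : EuclideanSpace ℝ (Fin (n + 1))) 1) := by
  rw [sphereMeasure, Measure.toSphere_real_apply_univ,
    Measure.addHaar_real_closedBall_eq_addHaar_real_ball, finrank_euclideanSpace, Fintype.card_fin]
  push_cast
  rfl

theorem volume_real_closedBall_pos :
    0 < volume.real (Metric.closedBall (0 : EuclideanSpace ℝ (Fin (n + 1))) 1) :=
  ENNReal.toReal_pos (Metric.measure_closedBall_pos volume 0 one_pos).ne'
    measure_closedBall_lt_top.ne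

theorem integrable_sphereMeasure
    {f : Metric.sphere (0 : EuclideanSpace ℝ (Fin (n + 1))) 1 → ℝ} (hf : Continuous f) :
    Integrable f (sphereMeasure n) :=
  hf.integrable_of_hasCompactSupport (HasCompactSupport.of_compactSpace f)

theorem continuous_supportFn_sphere : Continuous
    fun x : Metric.sphere (0 : EuclideanSpace ℝ (Fin (n + 1))) 1 => supportFn Ω z₀ x :=
  (continuous_supportFn Ω z₀).comp continuous_subtype_val

theorem continuous_inv_supportFn_sphere
    (hpos : ∀ x ∈ Metric.sphere (0 : EuclideanSpace ℝ (Fin (n + 1))) 1, 0 < supportFn Ω z₀ x) :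
    Continuous fun x : Metric.sphere (0 : EuclideanSpace ℝ (Fin (n + 1))) 1 =>
      (supportFn Ω z₀ x)⁻¹ :=
  continuous_supportFn_sphere.inv₀ fun x => (hpos x x.2).ne'

theorem continuous_log_supportFn_sphere
    (hpos : ∀ x ∈ Metric.sphere (0 : EuclideanSpace ℝ (Fin (n + 1))) 1, 0 < supportFn Ω z₀ x) :
    Continuous fun x : Metric.sphere (0 : EuclideanSpace ℝ (Fin (n + 1))) 1 =>
      Real.log (supportFn Ω z₀ x) :=
  continuous_supportFn_sphere.log fun x => (hpos x x.2).ne'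

/-- Polar coordinates: in direction x, u < 1 means radius below 1/u(x). The origin and the boundary
{u = 1} are left out, so only an inequality results, which is the direction needed. -/
theorem lintegral_inv_supportFn_pow_le
    (hpos : ∀ x ∈ Metric.sphere (0 : EuclideanSpace ℝ (Fin (n + 1))) 1, 0 < supportFn Ω z₀ x) :
    ∫⁻ x : Metric.sphere (0 : EuclideanSpace ℝ (Fin (n + 1))) 1,
      ENNReal.ofReal ((supportFn Ω z₀ x)⁻¹ ^ (n + 1) / (n + 1)) ∂(sphereMeasure n) ≤
        volume (polarDual Ω z₀) := by
  have hu := (continuous_supportFn Ω z₀).measurable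
  set A := {x | supportFn Ω z₀ x < 1} with hA
  have hAm : MeasurableSet A := measurableSet_lt hu measurable_const
  have hmp := (volume : Measure (EuclideanSpace ℝ (Fin (n + 1)))).measurePreserving_homeomorphUnitSphereProd
  set T : Set (Metric.sphere (0 : EuclideanSpace ℝ (Fin (n + 1))) 1 × Ioi (0 : ℝ)) :=
    {q | q.2.1 * supportFn Ω z₀ q.1 < 1} with hT
  have hTm : MeasurableSet T := by
    refine measurableSet_lt (Measurable.mul (by fun_prop) ?_) measurable_const
    exact hu.comp (measurable_subtype_coe.comp measurable_fst)
  have e1 : (homeomorphUnitSphereProd (EuclideanSpace ℝ (Fin (n + 1)))) ⁻¹' T =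
      ((↑) : ({0}ᶜ : Set (EuclideanSpace ℝ (Fin (n + 1)))) → _) ⁻¹' A := by
    ext x
    have hx : 0 < ‖x.1‖ := norm_pos_iff.2 x.2
    simp only [hT, hA, mem_preimage, mem_ofPred_eq, homeomorphUnitSphereProd_apply_snd_coe,
      homeomorphUnitSphereProd_apply_fst_coe]
    rw [← supportFn_smul Ω z₀ hx, smul_smul, mul_inv_cancel₀ hx.ne', one_smul]
  have e2 := hmp.measure_preimage hTm.nullMeasurableSet
  rw [e1, Measure.prod_apply hTm, comap_subtype_coe_apply (measurableSet_singleton _).compl,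
    finrank_euclideanSpace, Fintype.card_fin, Nat.add_sub_cancel] at e2
  have e3 : ∀ x : Metric.sphere (0 : EuclideanSpace ℝ (Fin (n + 1))) 1,
      Measure.volumeIoiPow n (Prod.mk x ⁻¹' T) =
        ENNReal.ofReal ((supportFn Ω z₀ x)⁻¹ ^ (n + 1) / (n + 1)) := fun x => by
    have hx := hpos x x.2
    rw [← Measure.volumeIoiPow_apply_Iio n ⟨(supportFn Ω z₀ x)⁻¹, inv_pos.2 hx⟩]
    congr 1
    ext t
    simp only [hT, mem_preimage, mem_ofPred_eq, mem_Iio, ← Subtype.coe_lt_coe]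
    rw [lt_inv_comm₀ t.2 hx, ← one_div, lt_div_iff₀ t.2, mul_comm]
  simp only [e3] at e2
  rw [sphereMeasure, ← e2, volume_polarDual]
  refine measure_mono ?_
  rintro _ ⟨x, hx, rfl⟩
  exact (show supportFn Ω z₀ x < 1 from hx).le

theorem integral_inv_supportFn_pow_le
    (hpos : ∀ x ∈ Metric.sphere (0 : EuclideanSpace ℝ (Fin (n + 1))) 1, 0 < supportFn Ω z₀ x)
    (hfin : volume (polarDual Ω z₀) ≠ ∞) :
    ∫ x : Metric.sphere (0 : EuclideanSpace ℝ (Fin (n + 1))) 1,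
      (supportFn Ω z₀ x)⁻¹ ^ (n + 1) ∂(sphereMeasure n) ≤
        (n + 1) * volume.real (polarDual Ω z₀) := by
  have hc : Continuous fun x : Metric.sphere (0 : EuclideanSpace ℝ (Fin (n + 1))) 1 =>
      (supportFn Ω z₀ x)⁻¹ ^ (n + 1) / ((n : ℝ) + 1) := by
    have := continuous_inv_supportFn_sphere hpos
    fun_prop
  have h := ENNReal.toReal_mono hfin (lintegral_inv_supportFn_pow_le hpos)
  rw [← integral_eq_lintegral_of_nonneg_ae (ae_of_all _ fun x => ?_) hc.aestronglyMeasurable,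
    integral_div, div_le_iff₀ (by positivity)] at h
  · rwa [mul_comm, measureReal_def]
  · have := hpos x x.2
    simp only [Pi.zero_apply]
    positivity

/-- This is log t ≤ t - 1 at t = u^{-d} / A. Keeping the pointwise gap, rather than quoting Jensen,
makes the equality case accessible. -/
theorem log_supportFn_gap_nonneg {A u : ℝ} (hA : 0 < A) (hu : 0 < u) (d : ℕ) :
    0 ≤ Real.log A + (u⁻¹ ^ d / A - 1) + d * Real.log u := by
  have h := Real.log_le_sub_one_of_pos (show 0 < u⁻¹ ^ d / A by positivity)
  rw [Real.log_div (by positivity) hA.ne', Real.log_pow, Real.log_inv] at h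
  linarith

theorem pow_eq_inv_of_log_gap_eq_zero {A u : ℝ} (hA : 0 < A) (hu : 0 < u) (d : ℕ)
    (h0 : Real.log A + (u⁻¹ ^ d / A - 1) + d * Real.log u = 0) : u ^ d = A⁻¹ := by
  by_contra hne
  have h1 : u⁻¹ ^ d / A ≠ 1 := fun h => hne (by
    rw [div_eq_one_iff_eq hA.ne', inv_pow] at h
    rw [← h, inv_inv])
  have h := Real.log_lt_sub_one_of_pos (show 0 < u⁻¹ ^ d / A by positivity) h1
  rw [Real.log_div (by positivity) hA.ne', Real.log_pow, Real.log_inv] at h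
  linarith

/-- With ω = (n+1) V(B), Blaschke–Santaló gives ∫ u^{-(n+1)} ≤ (n+1) V(B)² / V(Ω) = ω A, so the
middle term of the gap integrates to at most 0. -/
theorem integral_log_gap_le
    (hV : 0 < volume.real (Ω : Set (EuclideanSpace ℝ (Fin (n + 1)))))
    (hpos : ∀ x ∈ Metric.sphere (0 : EuclideanSpace ℝ (Fin (n + 1))) 1, 0 < supportFn Ω z₀ x)
    (hfin : volume (polarDual Ω z₀) ≠ ∞)
    (hBS : volume.real (Ω : Set (EuclideanSpace ℝ (Fin (n + 1)))) * volume.real (polarDual Ω z₀) ≤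
      volume.real (Metric.closedBall (0 : EuclideanSpace ℝ (Fin (n + 1))) 1) ^ 2) {A : ℝ}
    (hA : A = volume.real (Metric.closedBall (0 : EuclideanSpace ℝ (Fin (n + 1))) 1) /
      volume.real (Ω : Set (EuclideanSpace ℝ (Fin (n + 1))))) :
    ∫ x : Metric.sphere (0 : EuclideanSpace ℝ (Fin (n + 1))) 1, (Real.log A +
      ((supportFn Ω z₀ x)⁻¹ ^ (n + 1) / A - 1) + (n + 1 : ℕ) * Real.log (supportFn Ω z₀ x))
        ∂(sphereMeasure n) ≤
      (sphereMeasure n).real univ * (Real.log A + (n + 1) * meanLogSupport Ω z₀) := by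
  have hB := volume_real_closedBall_pos (n := n)
  have hω := sphereMeasure_real_univ (n := n)
  set B := volume.real (Metric.closedBall (0 : EuclideanSpace ℝ (Fin (n + 1))) 1)
  set V := volume.real (Ω : Set (EuclideanSpace ℝ (Fin (n + 1))))
  have hA0 : 0 < A := by rw [hA]; positivity
  have hωp : 0 < (sphereMeasure n).real univ := by rw [hω]; positivity
  have hi1 : Integrable (fun x : Metric.sphere (0 : EuclideanSpace ℝ (Fin (n + 1))) 1 =>
      (supportFn Ω z₀ x)⁻¹ ^ (n + 1) / A) (sphereMeasure n) := by
    refine integrable_sphereMeasure ?_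
    have := continuous_inv_supportFn_sphere hpos
    fun_prop
  have hi2 : Integrable (fun x : Metric.sphere (0 : EuclideanSpace ℝ (Fin (n + 1))) 1 =>
      ((n + 1 : ℕ) : ℝ) * Real.log (supportFn Ω z₀ x)) (sphereMeasure n) :=
    (integrable_sphereMeasure (continuous_log_supportFn_sphere hpos)).const_mul _
  have hi3 : Integrable (fun x : Metric.sphere (0 : EuclideanSpace ℝ (Fin (n + 1))) 1 =>
      (supportFn Ω z₀ x)⁻¹ ^ (n + 1) / A - 1) (sphereMeasure n) := hi1.sub (integrable_const 1)
  have hi4 : Integrable (fun x : Metric.sphere (0 : EuclideanSpace ℝ (Fin (n + 1))) 1 =>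
      Real.log A + ((supportFn Ω z₀ x)⁻¹ ^ (n + 1) / A - 1)) (sphereMeasure n) :=
    (integrable_const _).add hi3
  rw [integral_add hi4 hi2, integral_add (integrable_const _) hi3,
    integral_sub hi1 (integrable_const 1), integral_div, integral_const_mul, integral_const,
    integral_const, smul_eq_mul, smul_eq_mul, meanLogSupport]
  have h1 := integral_inv_supportFn_pow_le hpos hfin
  have h2 : (∫ x : Metric.sphere (0 : EuclideanSpace ℝ (Fin (n + 1))) 1,
      (supportFn Ω z₀ x)⁻¹ ^ (n + 1) ∂(sphereMeasure n)) / A ≤ (sphereMeasure n).real univ := by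
    rw [div_le_iff₀ hA0, hω, hA]
    refine h1.trans ?_
    rw [mul_assoc]
    refine mul_le_mul_of_nonneg_left ?_ (by positivity)
    rw [← mul_div_assoc, le_div_iff₀ hV]
    linarith
  push_cast
  field_simp at h2 ⊢
  linarith

theorem le_meanLogSupport
    (hV : 0 < volume.real (Ω : Set (EuclideanSpace ℝ (Fin (n + 1)))))
    (hpos : ∀ x ∈ Metric.sphere (0 : EuclideanSpace ℝ (Fin (n + 1))) 1, 0 < supportFn Ω z₀ x)
    (hfin : volume (polarDual Ω z₀) ≠ ∞)
    (hBS : volume.real (Ω : Set (EuclideanSpace ℝ (Fin (n + 1)))) * volume.real (polarDual Ω z₀) ≤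
      volume.real (Metric.closedBall (0 : EuclideanSpace ℝ (Fin (n + 1))) 1) ^ 2) :
    (Real.log (volume.real (Ω : Set (EuclideanSpace ℝ (Fin (n + 1))))) -
      Real.log (volume.real (Metric.closedBall (0 : EuclideanSpace ℝ (Fin (n + 1))) 1))) / (n + 1) ≤
        meanLogSupport Ω z₀ := by
  have h := integral_log_gap_le hV hpos hfin hBS rfl
  have hB := volume_real_closedBall_pos (n := n)
  have h0 := (integral_nonneg (μ := sphereMeasure n) fun x =>
    log_supportFn_gap_nonneg (div_pos hB hV) (hpos x x.2) (n + 1)).trans h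
  have hωp : 0 < (sphereMeasure n).real univ := by rw [sphereMeasure_real_univ]; positivity
  have h1 := nonneg_of_mul_nonneg_right h0 hωp
  rw [Real.log_div hB.ne' hV.ne'] at h1
  rw [div_le_iff₀ (by positivity)]
  linarith

/-- Here A = 1 and the nonnegative continuous gap has integral 0. As the surface measure charges
open sets, the gap vanishes at every point. -/
theorem supportFn_eq_one_of_meanLogSupport_eq_zero
    (hV : volume.real (Ω : Set (EuclideanSpace ℝ (Fin (n + 1)))) =
      volume.real (Metric.closedBall (0 : EuclideanSpace ℝ (Fin (n + 1))) 1))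
    (hpos : ∀ x ∈ Metric.sphere (0 : EuclideanSpace ℝ (Fin (n + 1))) 1, 0 < supportFn Ω z₀ x)
    (hfin : volume (polarDual Ω z₀) ≠ ∞)
    (hBS : volume.real (Ω : Set (EuclideanSpace ℝ (Fin (n + 1)))) * volume.real (polarDual Ω z₀) ≤
      volume.real (Metric.closedBall (0 : EuclideanSpace ℝ (Fin (n + 1))) 1) ^ 2)
    (h0 : meanLogSupport Ω z₀ = 0) :
    ∀ x ∈ Metric.sphere (0 : EuclideanSpace ℝ (Fin (n + 1))) 1, supportFn Ω z₀ x = 1 := by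
  have hB := volume_real_closedBall_pos (n := n)
  have h := integral_log_gap_le (A := 1) (hV ▸ hB) hpos hfin hBS (by rw [hV, div_self hB.ne'])
  have hc : Continuous fun x : Metric.sphere (0 : EuclideanSpace ℝ (Fin (n + 1))) 1 => Real.log 1 +
      ((supportFn Ω z₀ x)⁻¹ ^ (n + 1) / 1 - 1) + (n + 1 : ℕ) * Real.log (supportFn Ω z₀ x) := by
    have h1 := continuous_inv_supportFn_sphere hpos
    have h2 := continuous_log_supportFn_sphere hpos
    fun_prop
  have hnn := fun x : Metric.sphere (0 : EuclideanSpace ℝ (Fin (n + 1))) 1 =>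
    log_supportFn_gap_nonneg one_pos (hpos x x.2) (n + 1)
  rw [h0, Real.log_one, mul_zero, add_zero, mul_zero] at h
  rw [Real.log_one] at hc hnn
  have hz := le_antisymm h (integral_nonneg hnn)
  rw [integral_eq_zero_iff_of_nonneg hnn (integrable_sphereMeasure hc),
    Continuous.ae_eq_iff_eq _ hc continuous_zero] at hz
  intro x hx
  have := pow_eq_inv_of_log_gap_eq_zero one_pos (hpos x hx) (n + 1)
    (by rw [Real.log_one]; exact congrFun hz ⟨x, hx⟩)
  rw [inv_one] at this
  exact (pow_eq_one_iff_of_nonneg (hpos x hx).le (by omega)).1 this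

/-- By homogeneity u is the norm away from 0. Testing u on z - z₀ gives one inclusion, and
separating a point from Ω by a hyperplane gives the other. -/
theorem eq_closedBall_of_supportFn_eq_one
    (h : ∀ x ∈ Metric.sphere (0 : EuclideanSpace ℝ (Fin (n + 1))) 1, supportFn Ω z₀ x = 1) :
    (Ω : Set (EuclideanSpace ℝ (Fin (n + 1)))) = Metric.closedBall z₀ 1 := by
  have hn : ∀ y ≠ 0, supportFn Ω z₀ y = ‖y‖ := fun y hy => by
    have hy' := norm_pos_iff.2 hy
    have := h (‖y‖⁻¹ • y) (by simp [norm_smul, hy'.ne'])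
    rwa [supportFn_smul Ω z₀ (inv_pos.2 hy'), inv_mul_eq_one₀ hy'.ne', eq_comm] at this
  refine Subset.antisymm (fun z hz => ?_) fun z hz => ?_
  · rw [Metric.mem_closedBall, dist_eq_norm]
    rcases eq_or_ne (z - z₀) 0 with h0 | h0
    · simp [h0]
    · have h1 := inner_le_supportFn z₀ hz (z - z₀)
      rw [hn _ h0, real_inner_self_eq_norm_sq] at h1
      have := norm_pos_iff.2 h0
      nlinarith
  · by_contra hzΩ
    obtain ⟨f, s, hf, hs⟩ :=
      geometric_hahn_banach_closed_point Ω.convex Ω.isCompact.isClosed hzΩ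
    set y := (InnerProductSpace.toDual ℝ (EuclideanSpace ℝ (Fin (n + 1)))).symm f with hy
    have hfy : ∀ x, f x = inner ℝ y x := fun x => by
      rw [hy, InnerProductSpace.toDual_symm_apply]
    obtain ⟨z₁, hz₁, e⟩ := exists_inner_eq_supportFn Ω z₀ y
    have h1 := (hf z₁ hz₁).trans hs
    have hy0 : y ≠ 0 := fun h0 => by
      rw [hfy, hfy, h0, inner_zero_left, inner_zero_left] at h1
      exact lt_irrefl _ h1
    rw [hn y hy0] at e
    have h2 : inner ℝ y (z - z₀) ≤ ‖y‖ * 1 := (real_inner_le_norm y _).trans (by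
      gcongr; rwa [← dist_eq_norm])
    rw [hfy, hfy] at h1
    rw [inner_sub_right] at e h2
    linarith

theorem supportFn_of_eq_closedBall {z : EuclideanSpace ℝ (Fin (n + 1))}
    (h : (Ω : Set (EuclideanSpace ℝ (Fin (n + 1)))) = Metric.closedBall z 1)
    {x : EuclideanSpace ℝ (Fin (n + 1))}
    (hx : x ∈ Metric.sphere (0 : EuclideanSpace ℝ (Fin (n + 1))) 1) : supportFn Ω z x = 1 := by
  have hx1 : ‖x‖ = 1 := by simpa using hx
  have hmem : ∀ w, w ∈ Ω ↔ ‖w - z‖ ≤ 1 := fun w => by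
    rw [← SetLike.mem_coe, h, Metric.mem_closedBall, dist_eq_norm]
  refine le_antisymm ((supportFn_le_iff Ω z).2 fun w hw => ?_) ?_
  · calc inner ℝ x (w - z) ≤ ‖x‖ * ‖w - z‖ := real_inner_le_norm _ _
      _ ≤ 1 := by rw [hx1, one_mul]; exact (hmem w).1 hw
  · have := inner_le_supportFn z ((hmem (z + x)).2 (by simp [hx1])) x
    simpa [real_inner_self_eq_norm_sq, hx1] using this

/-- Here u_{z₀}(x) = 1 - ⟨x, z₀ - z⟩, so log u_{z₀} is at most a linear function, whose integral
over the sphere is 0. -/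
theorem meanLogSupport_nonpos_of_eq_closedBall {z : EuclideanSpace ℝ (Fin (n + 1))}
    (h : (Ω : Set (EuclideanSpace ℝ (Fin (n + 1)))) = Metric.closedBall z 1)
    (hpos : ∀ x ∈ Metric.sphere (0 : EuclideanSpace ℝ (Fin (n + 1))) 1, 0 < supportFn Ω z₀ x) :
    meanLogSupport Ω z₀ ≤ 0 := by
  rw [meanLogSupport]
  refine mul_nonpos_of_nonneg_of_nonpos (by positivity) ?_
  rw [← neg_eq_zero.2 (integral_inner_sphereMeasure (z₀ - z)), ← integral_neg]
  refine integral_mono (integrable_sphereMeasure (continuous_log_supportFn_sphere hpos))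
    (integrable_sphereMeasure (by fun_prop)) fun x => ?_
  have h1 := Real.log_le_sub_one_of_pos (hpos x x.2)
  have h2 := supportFn_eq_sub Ω z z₀ x
  rw [supportFn_of_eq_closedBall h x.2] at h2
  simp only
  linarith

theorem meanLogSupport_eq_zero_of_eq_closedBall
    (h : (Ω : Set (EuclideanSpace ℝ (Fin (n + 1)))) = Metric.closedBall z₀ 1) :
    meanLogSupport Ω z₀ = 0 := by
  have : ∀ x : Metric.sphere (0 : EuclideanSpace ℝ (Fin (n + 1))) 1,
      Real.log (supportFn Ω z₀ x) = 0 := fun x => by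
    rw [supportFn_of_eq_closedBall h x.2, Real.log_one]
  simp [meanLogSupport, this]

end Entropy

/-! ### Santaló points, entropy and the conclusion -/

section Final

variable {n : ℕ} {Ω : ConvexBody (EuclideanSpace ℝ (Fin (n + 1)))}
  {z₀ : EuclideanSpace ℝ (Fin (n + 1))}

theorem supportFn_pos_of_volume_polarDual_ne_top (hz₀ : z₀ ∈ Ω)
    (hfin : volume (polarDual Ω z₀) ≠ ∞) :
    ∀ x ∈ Metric.sphere (0 : EuclideanSpace ℝ (Fin (n + 1))) 1, 0 < supportFn Ω z₀ x := by
  intro x hx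
  by_contra! h
  exact hfin (volume_polarDual_eq_top hz₀ (ne_zero_of_mem_unit_sphere ⟨x, hx⟩) h)

theorem meanLogSupport_le_entropy (hz₀ : z₀ ∈ Ω)
    (hpos : ∀ x ∈ Metric.sphere (0 : EuclideanSpace ℝ (Fin (n + 1))) 1, 0 < supportFn Ω z₀ x) :
    (meanLogSupport Ω z₀ : EReal) ≤ entropy Ω :=
  le_sSup ⟨z₀, hz₀, hpos, rfl⟩

/-- A compact convex set with empty interior is its own frontier, which is null. So the volume
normalization already supplies the interior that `ConvexBody` does not require. -/
theorem interior_nonempty_of_volume_ne_zero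
    (h : volume (Ω : Set (EuclideanSpace ℝ (Fin (n + 1)))) ≠ 0) :
    (interior (Ω : Set (EuclideanSpace ℝ (Fin (n + 1))))).Nonempty := by
  by_contra hne
  rw [not_nonempty_iff_eq_empty] at hne
  have h1 := Ω.convex.addHaar_frontier volume
  rw [frontier, hne, sdiff_empty, Ω.isCompact.isClosed.closure_eq] at h1
  exact h h1

theorem volume_real_pos (h : (interior (Ω : Set (EuclideanSpace ℝ (Fin (n + 1))))).Nonempty) :
    0 < volume.real (Ω : Set (EuclideanSpace ℝ (Fin (n + 1)))) :=
  ENNReal.toReal_pos ((isOpen_interior.measure_pos volume h).trans_le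
    (measure_mono interior_subset)).ne' Ω.isCompact.measure_lt_top.ne

/-- The Blaschke–Santaló inequality for the polar dual with respect to a Santaló point. -/
theorem IsSantaloPoint.volume_mul_volume_polarDual_le
    (hΩ : (interior (Ω : Set (EuclideanSpace ℝ (Fin (n + 1))))).Nonempty)
    (h : IsSantaloPoint Ω z₀) : volume (polarDual Ω z₀) ≠ ∞ ∧
      volume.real (Ω : Set (EuclideanSpace ℝ (Fin (n + 1)))) * volume.real (polarDual Ω z₀) ≤
        volume.real (Metric.closedBall (0 : EuclideanSpace ℝ (Fin (n + 1))) 1) ^ 2 := by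
  obtain ⟨z, hz, hle⟩ := exists_mem_interior_volume_mul_volume_polarDual_le hΩ
  have hfin := volume_polarDual_ne_top Ω z hz
  have hmin := h.2 z (interior_subset hz)
  exact ⟨ne_top_of_le_ne_top hfin hmin, (mul_le_mul_of_nonneg_left
    (ENNReal.toReal_mono hfin hmin) measureReal_nonneg).trans hle⟩

theorem entropy_nonpos_of_eq_closedBall
    (h : (Ω : Set (EuclideanSpace ℝ (Fin (n + 1)))) = Metric.closedBall z₀ 1) :
    entropy Ω ≤ 0 := by
  refine sSup_le ?_
  rintro _ ⟨z, -, hpos, rfl⟩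
  exact_mod_cast meanLogSupport_nonpos_of_eq_closedBall h hpos

end Final

end BlaschkeSantalo

theorem mainTheorem4 (n : ℕ) :
    (∀ Ω : ConvexBody (EuclideanSpace ℝ (Fin (n + 1))),
      volume (Ω : Set (EuclideanSpace ℝ (Fin (n + 1)))) =
        volume (Metric.closedBall (0 : EuclideanSpace ℝ (Fin (n + 1))) 1) →
      (∃! z, IsSantaloPoint Ω z) ∧
      0 ≤ entropy Ω ∧
      ∀ z_s, IsSantaloPoint Ω z_s →
        0 ≤ meanLogSupport Ω z_s ∧
        (meanLogSupport Ω z_s = 0 ↔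
          (Ω : Set (EuclideanSpace ℝ (Fin (n + 1)))) = Metric.closedBall z_s 1) ∧
        (entropy Ω = 0 ↔
          (Ω : Set (EuclideanSpace ℝ (Fin (n + 1)))) = Metric.closedBall z_s 1)) ∧
    (∀ Ω : ConvexBody (EuclideanSpace ℝ (Fin (n + 1))),
      (interior (Ω : Set (EuclideanSpace ℝ (Fin (n + 1))))).Nonempty →
      (((Real.log (volume.real (Ω : Set (EuclideanSpace ℝ (Fin (n + 1))))) -
          Real.log (volume.real
            (Metric.closedBall (0 : EuclideanSpace ℝ (Fin (n + 1))) 1))) / (n + 1) : ℝ) : EReal) ≤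
        entropy Ω) := by
  refine ⟨fun Ω hV => ?_, fun Ω hΩ => ?_⟩
  · have hVr : volume.real (Ω : Set (EuclideanSpace ℝ (Fin (n + 1)))) =
        volume.real (Metric.closedBall (0 : EuclideanSpace ℝ (Fin (n + 1))) 1) := by
      rw [measureReal_def, hV, measureReal_def]
    have hΩ := interior_nonempty_of_volume_ne_zero (Ω := Ω) (by
      rw [hV]; exact (Metric.measure_closedBall_pos volume 0 one_pos).ne')
    have main : ∀ z_s, IsSantaloPoint Ω z_s →
        (∀ x ∈ Metric.sphere (0 : EuclideanSpace ℝ (Fin (n + 1))) 1, 0 < supportFn Ω z_s x) ∧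
        0 ≤ meanLogSupport Ω z_s ∧ (meanLogSupport Ω z_s = 0 →
          (Ω : Set (EuclideanSpace ℝ (Fin (n + 1)))) = Metric.closedBall z_s 1) := by
      intro z_s hs
      obtain ⟨hfin, hBS⟩ := hs.volume_mul_volume_polarDual_le hΩ
      have hpos := supportFn_pos_of_volume_polarDual_ne_top hs.1 hfin
      refine ⟨hpos, ?_, fun h0 => eq_closedBall_of_supportFn_eq_one
        (supportFn_eq_one_of_meanLogSupport_eq_zero hVr hpos hfin hBS h0)⟩
      have := le_meanLogSupport (volume_real_pos hΩ) hpos hfin hBS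
      rwa [hVr, sub_self, zero_div] at this
    obtain ⟨z, hz⟩ := exists_isSantaloPoint Ω
    have hE : ∀ z_s, IsSantaloPoint Ω z_s → (meanLogSupport Ω z_s : EReal) ≤ entropy Ω :=
      fun z_s hs => meanLogSupport_le_entropy hs.1 (main z_s hs).1
    have hE0 : 0 ≤ entropy Ω :=
      le_trans (by exact_mod_cast (main z hz).2.1) (hE z hz)
    refine ⟨⟨z, hz, fun w hw => hw.eq hz (hw.volume_mul_volume_polarDual_le hΩ).1⟩, hE0,
      fun z_s hs => ?_⟩
    obtain ⟨-, hnn, hball⟩ := main z_s hs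
    refine ⟨hnn, ⟨hball, meanLogSupport_eq_zero_of_eq_closedBall⟩,
      fun h0 => hball (le_antisymm ?_ hnn),
      fun h => le_antisymm (entropy_nonpos_of_eq_closedBall h) hE0⟩
    have := hE z_s hs
    rw [h0] at this
    exact_mod_cast this
  -- For the bound without normalization the barycenter is itself an admissible point in the
  -- supremum.
  · obtain ⟨z, hz, hBS⟩ := exists_mem_interior_volume_mul_volume_polarDual_le hΩ
    have hfin := volume_polarDual_ne_top Ω z hz
    have hpos := supportFn_pos_of_volume_polarDual_ne_top (interior_subset hz) hfin
    exact le_trans (EReal.coe_le_coe_iff.2 (le_meanLogSupport (volume_real_pos hΩ) hpos hfin hBS))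
      (meanLogSupport_le_entropy (interior_subset hz) hpos)
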